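/- Let $d\in\mathbb{N}$, let $a:\mathbb{R}^d\times\mathbb{R}^d\to\mathbb{R}$ be a real symbol of class $S^0_{0,0}$, i.e. a smooth function with $\sup_{x,\xi}|\partial_x^\alpha\partial_\xi^\beta a(x,\xi)|<\infty$ for all multi-indices $\alpha,\beta\in\mathbb{N}^d$, and let $F:\mathbb{R}^d\to\mathbb{R}^d$ be a smooth map all of whose partial derivatives of every order $\ge 1$ are bounded on $\mathbb{R}^d$ ($F$ itself may grow linearly). For $\delta\in\mathbb{R}$ put $a[F]_\delta(x,\xi):=a(x+F(\delta x),\xi)$ and let $K_\delta$ be the Weyl quantization of $a[F]_\delta$. Explicitly, $K_\delta$ is the unique bounded operator on $L^2(\mathbb{R}^d)$ such that $$\langle\psi,K_\delta\phi\rangle=(2\pi)^{-d}\int_{\mathbb{R}^d}d\xi\int_{\mathbb{R}^{2d}}dx'\,dx\;e^{i\xi\cdot(x-x')}\,a[F]_\delta\big((x+x')/2,\xi\big)\,\overline{\psi(x)}\,\phi(x')$$ for all Schwartz functions $\psi,\phi\in\mathscr{S}(\mathbb{R}^d)$, where $\langle\cdot,\cdot\rangle$ is the scalar product of $L^2(\mathbb{R}^d)$,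 antilinear in the first variable. This operator exists and is self-adjoint for every $\delta\in\mathbb{R}$. Let $E_+(\delta):=\sup\sigma(K_\delta)$ and $E_-(\delta):=\inf\sigma(K_\delta)$ be the edges of its spectrum. Then there exists a constant $C>0$ (depending on $d$, $a$ and $F$, but not on $\delta$) such that $$|E_+(\delta)-E_+(0)|\le C|\delta|\quad\text{and}\quad|E_-(\delta)-E_-(0)|\le C|\delta|\qquad\text{for all }|\delta|\le 1.$$ -/

import Mathlib

open MeasureTheory
open scoped SchwartzMap ContDiff

noncomputable section

namespace WeylEdges

/-- The Euclidean space `ℝᵈ`. -/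
abbrev Eucl (d : ℕ) : Type := EuclideanSpace ℝ (Fin d)

/-- The Hilbert space `L²(ℝᵈ)` of complex-valued functions, with Lebesgue measure. -/
abbrev L2 (d : ℕ) : Type := Lp ℂ 2 (volume : Measure (Eucl d))

/-- Real Hörmander symbols of class `S⁰₀,₀(ℝᵈ × ℝᵈ)`: smooth functions on phase space all of whose
derivatives, of every order `n ≥ 0`, are bounded. -/
structure IsSymbol {d : ℕ} (a : Eucl d × Eucl d → ℝ) : Prop where
  smooth : ContDiff ℝ ∞ a
  bounded : ∀ n : ℕ, ∃ C : ℝ, ∀ p, ‖iteratedFDeriv ℝ n a p‖ ≤ C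

/-- Smooth maps `F : ℝᵈ → ℝᵈ` all of whose derivatives of order `n ≥ 1` are bounded; `F` itself may
grow linearly. -/
structure IsShift {d : ℕ} (F : Eucl d → Eucl d) : Prop where
  smooth : ContDiff ℝ ∞ F
  bounded : ∀ n : ℕ, 1 ≤ n → ∃ C : ℝ, ∀ x, ‖iteratedFDeriv ℝ n F x‖ ≤ C

/-- The perturbed symbol `a[F]_δ(x, ξ) = a(x + F(δ x), ξ)`. -/
def perturbed {d : ℕ} (a : Eucl d × Eucl d → ℝ) (F : Eucl d → Eucl d) (δ : ℝ) :
    Eucl d × Eucl d → ℝ :=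
  fun p => a (p.1 + F (δ • p.1), p.2)

/-- The sesquilinear form of the Weyl quantization of `b`, on Schwartz functions:
`(2π)⁻ᵈ ∫ dξ ∫∫ dx dx' exp(i ξ·(x - x')) b((x + x')/2, ξ) conj(ψ(x)) φ(x')`.
In the inner integral `p = (x, x')`. -/
def weylForm {d : ℕ} (b : Eucl d × Eucl d → ℝ) (ψ φ : 𝓢(Eucl d, ℂ)) : ℂ :=
  (((2 * Real.pi) ^ d)⁻¹ : ℝ) *
    ∫ ξ : Eucl d, ∫ p : Eucl d × Eucl d,
      Complex.exp (Complex.I * (inner ℝ ξ (p.1 - p.2) : ℝ)) *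
        (b ((1 / 2 : ℝ) • (p.1 + p.2), ξ) : ℂ) * (starRingEnd ℂ) (ψ p.1) * φ p.2

/-- The bounded operator `A` on `L²(ℝᵈ)` is the Weyl quantization of the symbol `b`:
`⟨ψ, A φ⟩` is the Weyl form of `b` for all Schwartz functions `ψ, φ`
(the scalar product is antilinear in the first variable). -/
def IsWeylQuantization {d : ℕ} (b : Eucl d × Eucl d → ℝ) (A : L2 d →L[ℂ] L2 d) : Prop :=
  ∀ ψ φ : 𝓢(Eucl d, ℂ),
    inner ℂ (ψ.toLp 2 (volume : Measure (Eucl d))) (A (φ.toLp 2 (volume : Measure (Eucl d)))) =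
      weylForm b ψ φ

/-- The upper spectral edge `E₊(A) = sup σ(A)` of a self-adjoint operator `A`. -/
def upperEdge {d : ℕ} (A : L2 d →L[ℂ] L2 d) : ℝ :=
  sSup {t : ℝ | (t : ℂ) ∈ spectrum ℂ A}

/-- The lower spectral edge `E₋(A) = inf σ(A)` of a self-adjoint operator `A`. -/
def lowerEdge {d : ℕ} (A : L2 d →L[ℂ] L2 d) : ℝ :=
  sInf {t : ℝ | (t : ℂ) ∈ spectrum ℂ A}

end WeylEdges

end

noncomputable section

namespace WeylEdges

set_option synthInstance.maxSize 1024

section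

/-! ### Phases and Gaussians -/

/-! The upper edge of a self-adjoint operator `A` is the least `E` with `⟨φ, Aφ⟩ ≤ E‖φ‖²` on
Schwartz functions (`upperEdge_le_iff`). The claim is therefore a comparison, in both directions, of
form bounds for `a` and `a[F]_δ`; the lower edge is the upper edge for `-a` with the sign reversed.

To get from `a` to `a[F]_δ`, decouple the scales: put `b(x, y, ξ) = a(x + F(y), ξ)`. Every slice of
constant `y` is a translate of `a`, so it inherits the form bound `E`; the symbol wanted is the
diagonal one, `y = δx`. Write `δ = εc` with `|ε| = |c| = √|δ|`, cut `f` off by Gaussians around `cx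
= u`, let the slice `y = εu` act on each piece and integrate over `u`. This superposition is exactly
the Gaussian average over `(v, η)` of the forms with symbol `b(x, δx - εv, ξ + cη)`
(`integral_weylForm_jitter`). It is at most `E` times the mass. Since the Gaussian is even, only
symmetric second differences separate the average from its value at `v = η = 0`. These are `O(ε² +
c²) = O(|δ|)` in the norm controlling the Weyl form (`norm_weylForm_le`), so the error in
`weylForm_diagonal_le` is linear in `|δ|`.

For the converse, `x ↦ x + F(δx)` is undone by a shift `s` of the same type, solving `s(y) + F(y + δ
s(y)) = 0`, with derivative bounds uniform in `δ` (`exists_inverse_shift`,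
`exists_posDerivBound_inverse_shift`). The forward estimate for `a[F]_δ` and `s` then returns `a`.
This needs `|δ| sup‖DF‖ ≤ 1/2`; for the other `δ` the uniform norm bound suffices.

The norm bound is a Calderón–Vaillancourt estimate with `2d + 1` derivatives. In Gaussian coherent
states the matrix elements are symplectic Fourier transforms of a localised symbol, hence decay off
the diagonal, and a Schur test concludes. The same estimate produces the operators `K δ`. -/

/-- The phase factor `e^{ir}`. -/
def osc (r : ℝ) : ℂ := Complex.exp (r * Complex.I)

lemma norm_osc (r : ℝ) : ‖osc r‖ = 1 := Complex.norm_exp_ofReal_mul_I r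

lemma osc_add (r s : ℝ) : osc (r + s) = osc r * osc s := by
  simp only [osc, ← Complex.exp_add]; congr 1; push_cast; ring

lemma conj_osc (r : ℝ) : (starRingEnd ℂ) (osc r) = osc (-r) := by
  simp only [osc, ← Complex.exp_conj]; congr 1; simp

@[fun_prop]
lemma continuous_osc : Continuous osc := by unfold osc; fun_prop

lemma pow_mul_exp_neg_mul_sq_le (c : ℝ) (hc : 0 < c) (k : ℕ) :
    ∃ C, ∀ r : ℝ, 0 ≤ r → r ^ k * Real.exp (-c * r ^ 2) ≤ C := by
  refine ⟨1 + k.factorial / c ^ k, fun r hr => ?_⟩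
  have h1 : r ^ k ≤ 1 + r ^ (2 * k) := by
    rcases le_total r 1 with h | h
    · have := pow_le_one₀ (n := k) hr h
      have : 0 ≤ r ^ (2 * k) := by positivity
      linarith
    · have := pow_le_pow_right₀ h (show k ≤ 2 * k by omega)
      linarith
  have h2 : (c * r ^ 2) ^ k / k.factorial ≤ Real.exp (c * r ^ 2) :=
    Real.pow_div_factorial_le_exp _ (by positivity) k
  have h3 : r ^ (2 * k) * Real.exp (-c * r ^ 2) ≤ k.factorial / c ^ k := by
    rw [neg_mul, Real.exp_neg, ← div_eq_mul_inv, div_le_div_iff₀ (Real.exp_pos _) (by positivity)]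
    rw [div_le_iff₀ (by positivity)] at h2
    calc r ^ (2 * k) * c ^ k = (c * r ^ 2) ^ k := by rw [mul_pow, ← pow_mul]; ring
      _ ≤ _ := by rw [mul_comm (k.factorial : ℝ)]; exact h2
  have h4 : Real.exp (-c * r ^ 2) ≤ 1 := by
    rw [Real.exp_le_one_iff]; have := mul_nonneg hc.le (sq_nonneg r); linarith
  calc r ^ k * Real.exp (-c * r ^ 2) ≤ (1 + r ^ (2 * k)) * Real.exp (-c * r ^ 2) := by gcongr
    _ = Real.exp (-c * r ^ 2) + r ^ (2 * k) * Real.exp (-c * r ^ 2) := by ring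
    _ ≤ _ := by linarith

/-! ### Gaussians of coercive quadratic forms are Schwartz. -/

section QuadraticExp
variable {V : Type*} [NormedAddCommGroup V] [NormedSpace ℝ V]

lemma contDiff_exp_neg_quadratic (B : V →L[ℝ] V →L[ℝ] ℝ) :
    ContDiff ℝ ∞ (fun x => Real.exp (-(B x x))) := by fun_prop

lemma fderiv_exp_neg_quadratic (B : V →L[ℝ] V →L[ℝ] ℝ) :
    fderiv ℝ (fun x => Real.exp (-(B x x))) =
      fun x => Real.exp (-(B x x)) • (-(B + B.flip)) x := by
  ext x v
  have h : HasFDerivAt (fun x => B x x) ((B + B.flip) x) x := by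
    convert! B.hasFDerivAt_of_bilinear (hasFDerivAt_id x) (hasFDerivAt_id x) using 1
  have h' : HasFDerivAt (fun x => Real.exp (-(B x x)))
      (Real.exp (-(B x x)) • -((B + B.flip) x)) x := h.neg.exp
  rw [h'.fderiv]
  simp

/-- Strong induction on `n`: the derivative of `exp (-B(x, x))` is the same function times a linear
map. Leibniz thus reduces order `n + 1` to orders at most `n` of the exponential, at the price of a
larger power of `‖x‖`; this is why all `k` are carried along. -/
lemma decay_exp_neg_quadratic (B : V →L[ℝ] V →L[ℝ] ℝ) {c : ℝ} (hc : 0 < c)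
    (hB : ∀ x, c * ‖x‖ ^ 2 ≤ B x x) (n : ℕ) : ∀ k : ℕ, ∃ C : ℝ, ∀ x,
      ‖x‖ ^ k * ‖iteratedFDeriv ℝ n (fun x => Real.exp (-(B x x))) x‖ ≤ C := by
  induction n using Nat.strong_induction_on with
  | _ n ih =>
    intro k
    rcases n with _ | n
    · obtain ⟨C, hC⟩ := pow_mul_exp_neg_mul_sq_le c hc k
      refine ⟨C, fun x => ?_⟩
      refine le_trans ?_ (hC ‖x‖ (norm_nonneg x))
      rw [norm_iteratedFDeriv_zero, Real.norm_eq_abs, Real.abs_exp]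
      gcongr
      linarith [hB x]
    · choose! D hD using fun i (hi : i < n + 1) k => ih i hi k
      have hlin := (-(B + B.flip)).hasTemperateGrowth
      choose l D' hD' using hlin.2
      refine ⟨∑ i ∈ Finset.range (n + 1), (n.choose i : ℝ) *
        (|D' (n - i)| * 2 ^ (l (n - i)) * (|D i k| + |D i (k + l (n - i))|)), fun x => ?_⟩
      rw [← norm_iteratedFDeriv_fderiv, fderiv_exp_neg_quadratic]
      have h1 := (ContinuousLinearMap.lsmul ℝ ℝ : ℝ →L[ℝ] (V →L[ℝ] ℝ) →L[ℝ] _)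
        |>.norm_iteratedFDeriv_le_of_bilinear_of_le_one (contDiff_exp_neg_quadratic B)
          (hlin.1) x (n := n) (mod_cast le_top) ContinuousLinearMap.opNorm_lsmul_le
      refine le_trans (mul_le_mul_of_nonneg_left h1 (by positivity)) ?_
      rw [Finset.mul_sum]
      refine Finset.sum_le_sum fun i hi => ?_
      have hi' : i < n + 1 := Finset.mem_range.1 hi
      have h2 : ‖iteratedFDeriv ℝ (n - i) (fun x => (-(B + B.flip)) x) x‖ ≤
          |D' (n - i)| * (2 ^ (l (n - i)) * (1 + ‖x‖ ^ (l (n - i)))) := by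
        refine (hD' (n - i) x).trans ?_
        gcongr
        · exact le_abs_self _
        · calc (1 + ‖x‖) ^ l (n - i) ≤ 2 ^ (l (n - i) - 1) * (1 ^ l (n - i) + ‖x‖ ^ l (n - i)) :=
                add_pow_le (by norm_num) (norm_nonneg x) _
            _ ≤ 2 ^ (l (n - i)) * (1 + ‖x‖ ^ l (n - i)) := by
                rw [one_pow]; gcongr
                · norm_num
                · omega
      set G := ‖iteratedFDeriv ℝ i (fun x => Real.exp (-(B x x))) x‖ with hG
      have h3 : ‖x‖ ^ k * G ≤ |D i k| := (hD i hi' k x).trans (le_abs_self _)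
      have h4 : ‖x‖ ^ (k + l (n - i)) * G ≤ |D i (k + l (n - i))| :=
        (hD i hi' _ x).trans (le_abs_self _)
      calc ‖x‖ ^ k * ((n.choose i : ℝ) * G * ‖iteratedFDeriv ℝ (n - i) (fun x => (-(B + B.flip)) x) x‖)
          ≤ ‖x‖ ^ k * ((n.choose i : ℝ) * G *
            (|D' (n - i)| * (2 ^ (l (n - i)) * (1 + ‖x‖ ^ (l (n - i)))))) := by gcongr
        _ = (n.choose i : ℝ) * (|D' (n - i)| * 2 ^ (l (n - i)) *
              (‖x‖ ^ k * G + ‖x‖ ^ (k + l (n - i)) * G)) := by rw [pow_add]; ring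
        _ ≤ _ := by gcongr

/-- The Gaussian `exp (-B(x, x))` of a coercive quadratic form, as a Schwartz function. -/
def quadraticGaussian (B : V →L[ℝ] V →L[ℝ] ℝ) {c : ℝ} (hc : 0 < c)
    (hB : ∀ x, c * ‖x‖ ^ 2 ≤ B x x) : 𝓢(V, ℝ) where
  toFun := fun x => Real.exp (-(B x x))
  smooth' := contDiff_exp_neg_quadratic B
  decay' := fun k n => decay_exp_neg_quadratic B hc hB n k

end QuadraticExp

variable {d : ℕ}

/-- The Gaussian `exp (-c ‖x‖²)` on `ℝᵈ`. -/
def gauss (c : ℝ) (x : Eucl d) : ℝ := Real.exp (-(c * ‖x‖ ^ 2))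

lemma gauss_pos (c : ℝ) (x : Eucl d) : 0 < gauss c x := Real.exp_pos _

@[fun_prop]
lemma continuous_gauss (c : ℝ) : Continuous (gauss c : Eucl d → ℝ) := by unfold gauss; fun_prop

lemma gauss_neg (c : ℝ) (x : Eucl d) : gauss c (-x) = gauss c x := by simp [gauss]

lemma gauss_le_one {c : ℝ} (hc : 0 ≤ c) (x : Eucl d) : gauss c x ≤ 1 := by
  rw [gauss, Real.exp_le_one_iff]; have := mul_nonneg hc (sq_nonneg ‖x‖); linarith

/-- `gauss c` as a Schwartz function, for `c > 0`. -/
def gaussS (c : ℝ) (hc : 0 < c) : 𝓢(Eucl d, ℝ) :=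
  quadraticGaussian (c • innerSL ℝ) hc (fun x => by
    change c * ‖x‖ ^ 2 ≤ c * inner ℝ x x
    rw [real_inner_self_eq_norm_sq])

lemma gaussS_apply (c : ℝ) (hc : 0 < c) (x : Eucl d) : gaussS c hc x = gauss c x := by
  change Real.exp (-(c * inner ℝ x x)) = Real.exp _
  rw [real_inner_self_eq_norm_sq]

lemma integrable_gauss {c : ℝ} (hc : 0 < c) : Integrable (gauss c : Eucl d → ℝ) := by
  convert (gaussS (d := d) c hc).integrable (μ := volume) using 1
  ext x; rw [gaussS_apply]

/-- The bilinear form of the squared Euclidean norm on phase space. -/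
def phaseForm (d : ℕ) : (Eucl d × Eucl d) →L[ℝ] (Eucl d × Eucl d) →L[ℝ] ℝ :=
  (innerSL ℝ).bilinearComp (ContinuousLinearMap.fst ℝ _ _) (ContinuousLinearMap.fst ℝ _ _) +
  (innerSL ℝ).bilinearComp (ContinuousLinearMap.snd ℝ _ _) (ContinuousLinearMap.snd ℝ _ _)

lemma phaseForm_apply (p : Eucl d × Eucl d) :
    phaseForm d p p = ‖p.1‖ ^ 2 + ‖p.2‖ ^ 2 := by
  rw [← real_inner_self_eq_norm_sq, ← real_inner_self_eq_norm_sq]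
  rfl

/-- The Gaussian `exp (-c (‖p.1‖² + ‖p.2‖²))` on phase space. -/
def phaseGauss (c : ℝ) (hc : 0 < c) : 𝓢(Eucl d × Eucl d, ℝ) :=
  quadraticGaussian (c • phaseForm d) hc (fun p => by
    change c * ‖p‖ ^ 2 ≤ c * phaseForm d p p
    rw [phaseForm_apply]
    gcongr
    rcases max_cases ‖p.1‖ ‖p.2‖ with h | h <;> rw [Prod.norm_def, h.1] <;> nlinarith)

lemma phaseGauss_apply (c : ℝ) (hc : 0 < c) (p : Eucl d × Eucl d) :
    phaseGauss c hc p = gauss c p.1 * gauss c p.2 := by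
  rw [gauss, gauss, ← Real.exp_add]
  change Real.exp (-(c * phaseForm d p p)) = Real.exp _
  rw [phaseForm_apply]
  congr 1; ring

/-- Fourier transform of a Gaussian. -/
lemma integral_osc_mul_gauss {b : ℝ} (hb : 0 < b) (w : Eucl d) :
    ∫ v : Eucl d, osc (inner ℝ w v) * (gauss b v : ℂ) =
      (((Real.pi / b) ^ ((d : ℝ) / 2) : ℝ) : ℂ) * (gauss (1 / (4 * b)) w : ℂ) := by
  have h := GaussianFourier.integral_cexp_neg_mul_sq_norm_add (V := Eucl d) (b := (b : ℂ))
    (by simpa using hb) Complex.I w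
  rw [finrank_euclideanSpace_fin] at h
  convert h using 1
  · congr 1; ext v
    rw [osc, gauss, Complex.ofReal_exp, ← Complex.exp_add]
    congr 1; push_cast; ring
  · congr 1
    · rw [Complex.ofReal_cpow (by positivity)]; push_cast; rfl
    · rw [gauss, Complex.ofReal_exp]
      congr 1; push_cast
      rw [Complex.I_sq]
      have : (b : ℂ) ≠ 0 := by exact_mod_cast hb.ne'
      field_simp

lemma integral_gauss {b : ℝ} (hb : 0 < b) :
    ∫ v : Eucl d, gauss b v = (Real.pi / b) ^ ((d : ℝ) / 2) := by
  have h := GaussianFourier.integral_rexp_neg_mul_sq_norm (V := Eucl d) hb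
  rw [finrank_euclideanSpace_fin] at h
  rw [← h]
  simp [gauss]

end

section

/-! ### The short-time Fourier transform with Gaussian window -/

/-! ### Polynomial weights. -/

section Weights
variable {V : Type*} [NormedAddCommGroup V]

/-- The weight `(1 + ‖x‖)⁻ᵏ`. -/
def wt (k : ℕ) (x : V) : ℝ := ((1 + ‖x‖) ^ k)⁻¹

lemma wt_pos (k : ℕ) (x : V) : 0 < wt k x := by unfold wt; positivity

@[fun_prop]
lemma continuous_wt (k : ℕ) : Continuous (wt k : V → ℝ) := by
  unfold wt
  exact Continuous.inv₀ (by fun_prop) (fun x => by positivity)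

lemma integrable_wt [NormedSpace ℝ V] [FiniteDimensional ℝ V] [MeasurableSpace V] [BorelSpace V]
    (μ : Measure V) [μ.IsAddHaarMeasure] {k : ℕ} (hk : Module.finrank ℝ V < k) :
    Integrable (wt k : V → ℝ) μ := by
  have h := integrable_one_add_norm (E := V) (μ := μ) (r := k) (by exact_mod_cast hk)
  convert h using 2 with x
  rw [wt, Real.rpow_neg (by positivity), Real.rpow_natCast]

/-- A Peetre-type inequality, `1 + ‖y‖ ≤ (1 + ‖x - y‖)(1 + ‖x‖)`. It converts decay in `x - y` and
in `x` into decay in the window centre `y`. -/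
lemma wt_add_le (k : ℕ) (x y : V) : wt k (x - y) * wt k x ≤ wt k y := by
  unfold wt
  rw [← mul_inv, ← mul_pow]
  gcongr
  have h : ‖y‖ ≤ ‖x - y‖ + ‖x‖ := by
    calc ‖y‖ = ‖x - (x - y)‖ := by simp
      _ ≤ ‖x‖ + ‖x - y‖ := norm_sub_le _ _
      _ = _ := add_comm _ _
  nlinarith [norm_nonneg (x - y), norm_nonneg x, mul_nonneg (norm_nonneg (x - y)) (norm_nonneg x)]

lemma le_wt_of_pow_mul_le {k : ℕ} {x : V} {a C₀ C₁ : ℝ} (h0 : a ≤ C₀)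
    (h1 : ‖x‖ ^ k * a ≤ C₁) (ha : 0 ≤ a) : a ≤ 2 ^ k * (C₀ + C₁) * wt k x := by
  rw [wt, ← div_eq_mul_inv, le_div_iff₀ (by positivity)]
  calc a * (1 + ‖x‖) ^ k ≤ a * (2 ^ (k - 1) * (1 ^ k + ‖x‖ ^ k)) := by
        gcongr; exact add_pow_le (by norm_num) (norm_nonneg x) _
    _ ≤ a * (2 ^ k * (1 + ‖x‖ ^ k)) := by
        rw [one_pow]; gcongr
        · norm_num
        · omega
    _ = 2 ^ k * (a + ‖x‖ ^ k * a) := by ring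
    _ ≤ _ := by gcongr

lemma schwartz_le_wt [NormedSpace ℝ V] {F : Type*} [NormedAddCommGroup F] [NormedSpace ℝ F] (f : 𝓢(V, F))
    (k n : ℕ) : ∃ C : ℝ, 0 ≤ C ∧ ∀ x, ‖iteratedFDeriv ℝ n f x‖ ≤ C * wt k x := by
  refine ⟨2 ^ k * (SchwartzMap.seminorm ℝ 0 n f + SchwartzMap.seminorm ℝ k n f),
    by positivity, fun x => ?_⟩
  exact le_wt_of_pow_mul_le (f.norm_iteratedFDeriv_le_seminorm ℝ n x) (f.le_seminorm ℝ k n x)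
    (norm_nonneg _)

end Weights

/-! ### Measure-preserving shears, used to dominate convolution-type integrands. -/

section Shear
variable {X : Type*} [MeasurableSpace X] {μ : Measure X} [SFinite μ]
  {V : Type*} [NormedAddCommGroup V] [NormedSpace ℝ V] [FiniteDimensional ℝ V] [MeasurableSpace V]
  [BorelSpace V] {ν : Measure V} [ν.IsAddHaarMeasure]

/-- The shear `(x, u) ↦ (x, θ(x) - u)` preserves the product measure. -/
lemma measurePreserving_shear {θ : X → V} (hθ : Measurable θ) :
    MeasurePreserving (fun p : X × V => (p.1, θ p.1 - p.2)) (μ.prod ν) (μ.prod ν) :=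
  (MeasurePreserving.id μ).skew_product (g := fun x u => θ x - u)
    (by fun_prop) (Filter.Eventually.of_forall fun x =>
      (Measure.measurePreserving_sub_left ν (θ x)).map_eq)

lemma integrable_shear {F : Type*} [NormedAddCommGroup F] {θ : X → V} (hθ : Measurable θ)
    {f : X × V → F} (hf : Integrable f (μ.prod ν)) :
    Integrable (fun p : X × V => f (p.1, θ p.1 - p.2)) (μ.prod ν) :=
  (measurePreserving_shear hθ).integrable_comp_of_integrable hf

end Shear

instance isAddHaarMeasure_phase {d : ℕ} : (volume : Measure (Eucl d × Eucl d)).IsAddHaarMeasure :=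
  Measure.prod.instIsAddHaarMeasure volume volume

lemma integrable_conj {X : Type*} [MeasurableSpace X] {μ : Measure X} {f : X → ℂ}
    (hf : Integrable f μ) : Integrable (fun x => (starRingEnd ℂ) (f x)) μ :=
  Complex.conjCLE.toContinuousLinearMap.integrable_comp hf

variable {d : ℕ}

/-- The coherent state centred at `z = (q, κ)`, with frequency normalised as in `𝓕`. -/
def tf (z : Eucl d × Eucl d) (x : Eucl d) : ℂ :=
  osc (2 * Real.pi * inner ℝ x z.2) * (gauss Real.pi (x - z.1) : ℂ)

@[fun_prop]
lemma continuous_tf : Continuous (fun p : (Eucl d × Eucl d) × Eucl d => tf p.1 p.2) := by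
  unfold tf; fun_prop

lemma continuous_tf_right (z : Eucl d × Eucl d) : Continuous (tf z) := by
  unfold tf; fun_prop

lemma norm_tf (z : Eucl d × Eucl d) (x : Eucl d) : ‖tf z x‖ = gauss Real.pi (x - z.1) := by
  rw [tf, norm_mul, norm_osc, one_mul, Complex.norm_real, Real.norm_of_nonneg (gauss_pos _ _).le]

lemma norm_tf_le_one (z : Eucl d × Eucl d) (x : Eucl d) : ‖tf z x‖ ≤ 1 :=
  (norm_tf z x).trans_le (gauss_le_one Real.pi_pos.le _)

lemma integrable_tf (z : Eucl d × Eucl d) : Integrable (tf z) := by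
  refine ((integrable_gauss Real.pi_pos).comp_sub_right z.1).mono'
    (continuous_tf_right z).aestronglyMeasurable ?_
  filter_upwards with x
  exact (norm_tf z x).le

/-- The short-time Fourier transform with Gaussian window. -/
def stft (φ : Eucl d → ℂ) (z : Eucl d × Eucl d) : ℂ :=
  ∫ x, (starRingEnd ℂ) (tf z x) * φ x

/-- The Schwartz function `x ↦ exp (-π ‖x - q‖²) φ x`. -/
def windowed (φ : 𝓢(Eucl d, ℂ)) (q : Eucl d) : 𝓢(Eucl d, ℂ) :=
  SchwartzMap.smulLeftCLM ℂ
    (SchwartzMap.compSubConstCLM ℝ q (gaussS Real.pi Real.pi_pos) : Eucl d → ℝ) φ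

lemma windowed_apply (φ : 𝓢(Eucl d, ℂ)) (q x : Eucl d) :
    windowed φ q x = (gauss Real.pi (x - q) : ℂ) * φ x := by
  rw [windowed, SchwartzMap.smulLeftCLM_apply_apply (SchwartzMap.hasTemperateGrowth _),
    SchwartzMap.compSubConstCLM_apply, gaussS_apply, Complex.real_smul]

/-- Opens the way to Plancherel, inversion and derivative bounds for `𝓕`, applied at fixed window
centre. -/
lemma stft_eq_fourier (φ : 𝓢(Eucl d, ℂ)) (q κ : Eucl d) :
    stft φ (q, κ) = (FourierTransform.fourier (windowed φ q)) κ := by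
  rw [SchwartzMap.fourier_coe, Real.fourier_eq', stft]
  congr 1; ext x
  rw [tf, map_mul, conj_osc, Complex.conj_ofReal, windowed_apply, osc, smul_eq_mul, mul_assoc]
  congr 3; push_cast; ring

lemma continuous_stft_integrand (φ : 𝓢(Eucl d, ℂ)) :
    Continuous (fun p : (Eucl d × Eucl d) × Eucl d => (starRingEnd ℂ) (tf p.1 p.2) * φ p.2) :=
  (Complex.continuous_conj.comp continuous_tf).mul (φ.continuous.comp continuous_snd)

lemma stronglyMeasurable_stft (φ : 𝓢(Eucl d, ℂ)) : StronglyMeasurable (stft φ) :=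
  (continuous_stft_integrand φ).stronglyMeasurable.integral_prod_right'

/-- By Leibniz, derivatives of the window decay in `x - q` and those of `φ` in `x`. Of the weight `M
+ (d + 1)` taken from `φ`, the part `M` is traded for decay in `q` by `wt_add_le`, and the part `d +
1` makes the integral over `x` converge. -/
lemma integral_iteratedFDeriv_windowed_le (φ : 𝓢(Eucl d, ℂ)) (M n : ℕ) :
    ∃ C : ℝ, 0 ≤ C ∧ ∀ q, ∫ x, ‖iteratedFDeriv ℝ n (windowed φ q) x‖ ≤ C * wt M q := by
  choose Cg hCg0 hCg using fun i => schwartz_le_wt (gaussS (d := d) Real.pi Real.pi_pos) M i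
  choose Cφ hCφ0 hCφ using fun i => schwartz_le_wt φ (M + (d + 1)) i
  set C := ∑ i ∈ Finset.range (n + 1), (n.choose i : ℝ) * Cg i * Cφ (n - i) with hC
  have hC0 : 0 ≤ C := Finset.sum_nonneg fun i _ => by have := hCg0 i; have := hCφ0 (n - i); positivity
  have hI : Integrable (wt (d + 1) : Eucl d → ℝ) := integrable_wt _ (by simp)
  refine ⟨C * ∫ x : Eucl d, wt (d + 1) x,
    mul_nonneg hC0 (integral_nonneg fun x => (wt_pos _ x).le), fun q => ?_⟩
  have key : ∀ x, ‖iteratedFDeriv ℝ n (windowed φ q) x‖ ≤ C * wt M q * wt (d + 1) x := by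
    intro x
    have h0 : (windowed φ q : Eucl d → ℂ) = fun x => gaussS Real.pi Real.pi_pos (x - q) • φ x := by
      ext x; rw [windowed_apply, gaussS_apply, Complex.real_smul]
    rw [h0]
    have hsm : ContDiff ℝ ∞ (fun x => gaussS (d := d) Real.pi Real.pi_pos (x - q)) :=
      ((gaussS Real.pi Real.pi_pos).smooth ⊤).comp (contDiff_id.sub contDiff_const)
    refine (norm_iteratedFDeriv_smul_le hsm (φ.smooth ⊤) x (n := n) (mod_cast le_top)).trans ?_
    rw [hC, Finset.sum_mul, Finset.sum_mul]
    refine Finset.sum_le_sum fun i _ => ?_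
    have h1 : ‖iteratedFDeriv ℝ i (fun x => gaussS (d := d) Real.pi Real.pi_pos (x - q)) x‖ ≤
        Cg i * wt M (x - q) := by
      rw [iteratedFDeriv_comp_sub]; exact hCg i _
    have h2 : wt (M + (d + 1)) x = wt M x * wt (d + 1) x := by
      unfold wt; rw [pow_add, mul_inv]
    have := hCg0 i
    have := hCφ0 (n - i)
    have hw1 := wt_pos M (x - q)
    have hw2 := wt_pos (d + 1) x
    calc _ ≤ (n.choose i : ℝ) * (Cg i * wt M (x - q)) * (Cφ (n - i) * wt (M + (d + 1)) x) := by
          gcongr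
          exact hCφ _ _
      _ = (n.choose i : ℝ) * Cg i * Cφ (n - i) * (wt M (x - q) * wt M x) * wt (d + 1) x := by
          rw [h2]; ring
      _ ≤ _ := by gcongr; exact wt_add_le _ _ _
  calc _ ≤ ∫ x : Eucl d, C * wt M q * wt (d + 1) x :=
        integral_mono_of_nonneg (Filter.Eventually.of_forall fun x => norm_nonneg _)
          (hI.const_mul _) (Filter.Eventually.of_forall key)
    _ = _ := by rw [integral_const_mul]; ring

/-- Decay in `κ` comes from derivatives of the windowed function through the Fourier transform;
their `L¹` norms supply the decay in `q`. -/
lemma norm_stft_le (φ : 𝓢(Eucl d, ℂ)) (M : ℕ) :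
    ∃ C : ℝ, 0 ≤ C ∧ ∀ q κ, ‖stft φ (q, κ)‖ ≤ C * (wt M q * wt M κ) := by
  choose D hD0 hD using fun n => integral_iteratedFDeriv_windowed_le φ M n
  have hb : ∀ n q κ, ‖κ‖ ^ n * ‖stft φ (q, κ)‖ ≤
      (2 ^ n * ∑ j ∈ Finset.range (n + 1), D j) * wt M q := by
    intro n q κ
    have h := Real.pow_mul_norm_iteratedFDeriv_fourier_le (K := ⊤) (N := ⊤)
      ((windowed φ q).smooth ⊤) (fun k n _ _ => (windowed φ q).integrable_pow_mul_iteratedFDeriv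
        volume k n) (k := 0) (n := n) le_top le_top κ
    rw [norm_iteratedFDeriv_zero, ← SchwartzMap.fourier_coe, ← stft_eq_fourier] at h
    refine h.trans ?_
    simp only [pow_zero, one_mul, Nat.cast_zero, mul_zero, zero_add, Finset.range_one]
    rw [mul_assoc, Finset.sum_mul, Finset.sum_product]
    simp only [Finset.sum_singleton, pow_zero, one_mul]
    gcongr with j hj
    exact hD j q
  set S : ℕ → ℝ := fun n => 2 ^ n * ∑ j ∈ Finset.range (n + 1), D j
  refine ⟨2 ^ M * (S 0 + S M), ?_, fun q κ => ?_⟩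
  · have : ∀ n, 0 ≤ S n := fun n => mul_nonneg (by positivity) (Finset.sum_nonneg fun j _ => hD0 j)
    have h0 := this 0
    have hM := this M
    positivity
  · have h0 := hb 0 q κ
    rw [pow_zero, one_mul] at h0
    refine (le_wt_of_pow_mul_le h0 (hb M q κ) (norm_nonneg _)).trans (le_of_eq ?_)
    ring

lemma integrable_stft (φ : 𝓢(Eucl d, ℂ)) : Integrable (stft φ) := by
  obtain ⟨C, _, hC⟩ := norm_stft_le φ (d + 1)
  have hI : Integrable (wt (d + 1) : Eucl d → ℝ) := integrable_wt _ (by simp)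
  exact ((hI.mul_prod hI).const_mul C).mono' (stronglyMeasurable_stft φ).aestronglyMeasurable
    (Filter.Eventually.of_forall fun z => hC z.1 z.2)

lemma integrable_norm_sq_stft (φ : 𝓢(Eucl d, ℂ)) : Integrable (fun z => ‖stft φ z‖ ^ 2) := by
  obtain ⟨C, hC0, hC⟩ := norm_stft_le φ 0
  refine ((integrable_stft φ).norm.const_mul C).mono'
    ((stronglyMeasurable_stft φ).norm.pow 2).aestronglyMeasurable
    (Filter.Eventually.of_forall fun z => ?_)
  rw [norm_pow, norm_norm, sq]
  have := hC z.1 z.2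
  simp only [wt, pow_zero, inv_one, mul_one] at this
  gcongr

lemma gauss_sq (c : ℝ) (x : Eucl d) : gauss c x ^ 2 = gauss (2 * c) x := by
  rw [gauss, gauss, sq, ← Real.exp_add]; congr 1; ring

/-- The squared `L²` norm of the Gaussian window. -/
def windowMass (d : ℕ) : ℝ := ∫ x : Eucl d, gauss (2 * Real.pi) x

lemma windowMass_pos (d : ℕ) : 0 < windowMass d := by
  rw [windowMass, integral_gauss (by positivity)]; positivity

/-- Plancherel in `κ` at fixed `q`; integrating the squared window over `q` then gives a constant
independent of `x`. -/
lemma integral_norm_sq_stft (φ : 𝓢(Eucl d, ℂ)) :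
    ∫ z, ‖stft φ z‖ ^ 2 = windowMass d * ∫ x, ‖φ x‖ ^ 2 := by
  have h1 : ∫ z, ‖stft φ z‖ ^ 2 = ∫ q : Eucl d, ∫ x, gauss (2 * Real.pi) (x - q) * ‖φ x‖ ^ 2 := by
    rw [Measure.volume_eq_prod, integral_prod _ (integrable_norm_sq_stft φ)]
    congr 1; ext q
    simp_rw [stft_eq_fourier]
    rw [SchwartzMap.integral_norm_sq_fourier]
    congr 1; ext x
    rw [windowed_apply, norm_mul, mul_pow, Complex.norm_real,
      Real.norm_of_nonneg (gauss_pos _ _).le, gauss_sq]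
  have hφ : Integrable (fun x => ‖φ x‖ ^ 2) := by
    have := (φ.memLp 2 volume).integrable_norm_pow (p := 2) (by norm_num)
    exact_mod_cast this
  rw [h1, integral_integral_swap]
  · simp_rw [integral_mul_const]
    have : ∀ x : Eucl d, ∫ q : Eucl d, gauss (2 * Real.pi) (x - q) = windowMass d := fun x =>
      integral_sub_left_eq_self (fun q => gauss (2 * Real.pi) q) volume x
    simp_rw [this]
    rw [integral_const_mul]
  · have h2 := hφ.mul_prod (integrable_gauss (d := d) (c := 2 * Real.pi) (by positivity))
    have h3 := (integrable_shear measurable_id h2).swap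
    refine h3.congr (Filter.Eventually.of_forall fun p => ?_)
    simp only [Function.comp, Function.uncurry, Prod.swap, id]
    ring

/-- Fourier inversion at fixed `q`. The window inside `tf` multiplies the one inside `stft`, whence
`gauss (2π)`. -/
lemma stft_inversion (φ : 𝓢(Eucl d, ℂ)) (q x : Eucl d) :
    ∫ κ, stft φ (q, κ) * tf (q, κ) x = (gauss (2 * Real.pi) (x - q) : ℂ) * φ x := by
  have h1 : FourierTransformInv.fourierInv (FourierTransform.fourier (windowed φ q)) x =
      windowed φ q x := by
    rw [FourierTransform.fourierInv_fourier_eq]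
  rw [SchwartzMap.fourierInv_coe, Real.fourierInv_eq'] at h1
  rw [windowed_apply] at h1
  rw [← gauss_sq, sq, Complex.ofReal_mul, mul_assoc, ← h1, ← integral_const_mul]
  congr 1; ext κ
  rw [stft_eq_fourier, tf, osc, smul_eq_mul, real_inner_comm]
  push_cast
  ring

/-- Coherent states reproduce: testing `φ` against `χ` is the same as testing the superposition of
coherent states with coefficients `stft φ`. -/
lemma stft_reproducing (φ : 𝓢(Eucl d, ℂ)) {χ : Eucl d → ℂ} (hχ : Integrable χ) :
    ∫ z, stft φ z * ∫ x, χ x * tf z x = windowMass d * ∫ x, χ x * φ x := by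
  have hbase : Integrable (fun p : (Eucl d × Eucl d) × Eucl d => stft φ p.1 * χ p.2) :=
    (integrable_stft φ).mul_prod hχ
  have hm : AEStronglyMeasurable (fun p : (Eucl d × Eucl d) × Eucl d => tf p.1 p.2) volume :=
    continuous_tf.aestronglyMeasurable
  have hF : Integrable (fun p : (Eucl d × Eucl d) × Eucl d =>
      (stft φ p.1 * χ p.2) * tf p.1 p.2) :=
    hbase.mul_bdd (c := 1) hm (Filter.Eventually.of_forall fun p => norm_tf_le_one _ _)
  simp_rw [mul_assoc] at hF
  simp_rw [← integral_const_mul]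
  rw [integral_integral_swap hF]
  congr 1; ext x
  have hz : Integrable (fun z => stft φ z * tf z x) :=
    (integrable_stft φ).mul_bdd (c := 1)
      (continuous_tf.comp (continuous_id.prodMk continuous_const)).aestronglyMeasurable
      (Filter.Eventually.of_forall fun p => norm_tf_le_one _ _)
  have e1 : ∀ z, stft φ z * (χ x * tf z x) = χ x * (stft φ z * tf z x) := fun z => by ring
  simp_rw [e1]
  rw [integral_const_mul, Measure.volume_eq_prod, integral_prod _ hz]
  simp_rw [stft_inversion]
  rw [integral_mul_const, integral_complex_ofReal, integral_sub_left_eq_self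
    (fun q => gauss (2 * Real.pi) q) volume x, windowMass]
  ring

end

section

variable {d : ℕ}

/-! ### The cross-Wigner function -/

/-- The cross-Wigner function of `f` and `h` at `(m, κ)`, written as an expectation of the phase
space reflection. -/
def wigner (f h : Eucl d → ℂ) (p : Eucl d × Eucl d) : ℂ :=
  2 ^ d * ∫ y, osc (4 * Real.pi * inner ℝ (p.1 - y) p.2) *
    (starRingEnd ℂ) (f ((2 : ℝ) • p.1 - y)) * h y

/-- The reflection `y ↦ 2m - y` exchanges the two arguments and reverses the phase. -/
lemma conj_wigner (f h : Eucl d → ℂ) (p : Eucl d × Eucl d) :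
    (starRingEnd ℂ) (wigner f h p) = wigner h f p := by
  rw [wigner, wigner, map_mul, map_pow, Complex.conj_ofNat, ← integral_conj,
    ← integral_sub_left_eq_self _ volume ((2 : ℝ) • p.1)]
  congr 2; ext y
  simp only [map_mul, conj_osc, Complex.conj_conj, sub_sub_cancel]
  rw [mul_right_comm]
  congr 3
  rw [← mul_neg, ← inner_neg_left]
  congr 2
  module

/-- `stft_reproducing` with the reflected and modulated `f` as test function. -/
lemma wigner_reproducing {f : Eucl d → ℂ} (hf : Integrable f) (φ : 𝓢(Eucl d, ℂ))
    (p : Eucl d × Eucl d) :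
    windowMass d * wigner f φ p = ∫ w, stft φ w * wigner f (tf w) p := by
  have hχ : Integrable (fun y => osc (4 * Real.pi * inner ℝ (p.1 - y) p.2) *
      (starRingEnd ℂ) (f ((2 : ℝ) • p.1 - y))) := by
    have h1 := integrable_conj (hf.comp_sub_left ((2 : ℝ) • p.1))
    refine h1.bdd_mul (c := 1) (Continuous.aestronglyMeasurable (by fun_prop))
      (Filter.Eventually.of_forall fun y => (norm_osc _).le)
  simp only [wigner]
  have e : ∀ w : Eucl d × Eucl d, ∀ I : ℂ, stft φ w * (2 ^ d * I) = 2 ^ d * (stft φ w * I) :=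
    fun w I => by ring
  simp_rw [e]
  rw [integral_const_mul, stft_reproducing φ hχ]
  ring

/-- The normalisation constant of the Wigner function of two coherent states. -/
def wignerMass (d : ℕ) : ℝ := 2 ^ d * (1 / 2) ^ ((d : ℝ) / 2)

lemma wignerMass_pos (d : ℕ) : 0 < wignerMass d := by unfold wignerMass; positivity

/-- The Wigner function of two coherent states: a Gaussian at the midpoint, times a phase. -/
lemma wigner_tf (z w p : Eucl d × Eucl d) :
    wigner (tf z) (tf w) p = wignerMass d *
      (osc (2 * Real.pi * (inner ℝ (z.1 - w.1) (p.2 - (1 / 2 : ℝ) • (z.2 + w.2)) +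
        inner ℝ p.1 (w.2 - z.2))) *
      (phaseGauss (2 * Real.pi) (by positivity) (p - (1 / 2 : ℝ) • (z + w)) : ℝ)) := by
  set m₀ := p.1 - (1 / 2 : ℝ) • (z.1 + w.1) with hm
  set k₀ := p.2 - (1 / 2 : ℝ) • (z.2 + w.2) with hk
  set A := 2 * Real.pi * (inner ℝ (z.1 - w.1) k₀ + inner ℝ p.1 (w.2 - z.2)) with hA
  have hG : (phaseGauss (2 * Real.pi) (by positivity) (p - (1 / 2 : ℝ) • (z + w)) : ℝ) =
      gauss (2 * Real.pi) m₀ * gauss (2 * Real.pi) k₀ := phaseGauss_apply _ _ _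
  -- This translation of `y` turns the window arguments into `m₀ - y` and `m₀ + y`. The
  -- parallelogram law then separates `m₀` from `y`, and what remains is the Fourier transform of a
  -- Gaussian at a multiple of `k₀`.
  rw [hG, wigner, ← integral_add_right_eq_self _ (p.1 - (1 / 2 : ℝ) • (z.1 - w.1))]
  have e : ∀ y : Eucl d,
      osc (4 * Real.pi * inner ℝ (p.1 - (y + (p.1 - (1 / 2 : ℝ) • (z.1 - w.1)))) p.2) *
        (starRingEnd ℂ) (tf z ((2 : ℝ) • p.1 - (y + (p.1 - (1 / 2 : ℝ) • (z.1 - w.1))))) *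
        tf w (y + (p.1 - (1 / 2 : ℝ) • (z.1 - w.1))) =
      osc A * (gauss (2 * Real.pi) m₀ : ℂ) *
        (osc (inner ℝ ((-(4 * Real.pi)) • k₀) y) * (gauss (2 * Real.pi) y : ℂ)) := by
    intro y
    have e1 : (2 : ℝ) • p.1 - (y + (p.1 - (1 / 2 : ℝ) • (z.1 - w.1))) - z.1 = m₀ - y := by
      rw [hm]; module
    have e2 : y + (p.1 - (1 / 2 : ℝ) • (z.1 - w.1)) - w.1 = m₀ + y := by
      rw [hm]; module
    have hg : gauss Real.pi (m₀ - y) * gauss Real.pi (m₀ + y) =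
        gauss (2 * Real.pi) m₀ * gauss (2 * Real.pi) y := by
      simp only [gauss, ← Real.exp_add]
      congr 1
      have := parallelogram_law_with_norm ℝ m₀ y
      linear_combination -Real.pi * this
    have hp : 4 * Real.pi * inner ℝ (p.1 - (y + (p.1 - (1 / 2 : ℝ) • (z.1 - w.1)))) p.2 +
        -(2 * Real.pi * inner ℝ ((2 : ℝ) • p.1 - (y + (p.1 - (1 / 2 : ℝ) • (z.1 - w.1)))) z.2) +
        2 * Real.pi * inner ℝ (y + (p.1 - (1 / 2 : ℝ) • (z.1 - w.1))) w.2 =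
        A + inner ℝ ((-(4 * Real.pi)) • k₀) y := by
      rw [hA, hk, real_inner_comm y]
      simp only [inner_add_left, inner_sub_left, inner_smul_left, inner_add_right,
        inner_sub_right, inner_smul_right, RCLike.conj_to_real]
      ring
    rw [tf, tf, map_mul, conj_osc, Complex.conj_ofReal, e1, e2]
    calc _ = (osc (4 * Real.pi * inner ℝ (p.1 - (y + (p.1 - (1 / 2 : ℝ) • (z.1 - w.1)))) p.2) *
          osc (-(2 * Real.pi * inner ℝ
            ((2 : ℝ) • p.1 - (y + (p.1 - (1 / 2 : ℝ) • (z.1 - w.1)))) z.2)) *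
          osc (2 * Real.pi * inner ℝ (y + (p.1 - (1 / 2 : ℝ) • (z.1 - w.1))) w.2)) *
          ((gauss Real.pi (m₀ - y) * gauss Real.pi (m₀ + y) : ℝ) : ℂ) := by push_cast; ring
      _ = _ := by rw [← osc_add, ← osc_add, hp, hg, osc_add]; push_cast; ring
  simp_rw [e]
  rw [integral_const_mul, integral_osc_mul_gauss (by positivity)]
  have h1 : gauss (1 / (4 * (2 * Real.pi))) ((-(4 * Real.pi)) • k₀) = gauss (2 * Real.pi) k₀ := by
    rw [gauss, gauss, norm_smul, mul_pow, norm_neg, Real.norm_of_nonneg (by positivity)]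
    congr 1
    field_simp
    ring
  have h2 : Real.pi / (2 * Real.pi) = 1 / 2 := by field_simp
  rw [h1, h2, wignerMass]
  push_cast
  ring

lemma continuous_wigner_tf : Continuous
    (fun t : ((Eucl d × Eucl d) × (Eucl d × Eucl d)) × (Eucl d × Eucl d) =>
      wigner (tf t.1.1) (tf t.1.2) t.2) := by
  simp_rw [wigner_tf]
  have := (phaseGauss (d := d) (2 * Real.pi) (by positivity)).continuous
  fun_prop

/-- The argument is written as midpoint minus `p`, the shape in which the shear lemma applies. -/
lemma norm_wigner_tf (z w p : Eucl d × Eucl d) : ‖wigner (tf z) (tf w) p‖ =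
    wignerMass d * phaseGauss (2 * Real.pi) (by positivity) ((1 / 2 : ℝ) • (z + w) - p) := by
  rw [wigner_tf, norm_mul, norm_mul, norm_osc, one_mul, Complex.norm_real, Complex.norm_real,
    Real.norm_of_nonneg (wignerMass_pos d).le, ← neg_sub, phaseGauss_apply, phaseGauss_apply]
  rw [Prod.fst_neg, Prod.snd_neg, gauss_neg, gauss_neg, Real.norm_of_nonneg]
  have := gauss_pos (2 * Real.pi) ((1 / 2 : ℝ) • (z + w) - p).1
  have := gauss_pos (2 * Real.pi) ((1 / 2 : ℝ) • (z + w) - p).2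
  positivity

lemma norm_wigner_tf_le (z w p : Eucl d × Eucl d) :
    ‖wigner (tf z) (tf w) p‖ ≤ wignerMass d := by
  rw [norm_wigner_tf, phaseGauss_apply]
  have h1 := gauss_le_one (c := 2 * Real.pi) (by positivity) ((1 / 2 : ℝ) • (z + w) - p).1
  have h2 := gauss_le_one (c := 2 * Real.pi) (by positivity) ((1 / 2 : ℝ) • (z + w) - p).2
  exact mul_le_of_le_one_right (wignerMass_pos d).le (mul_le_one₀ h1 (gauss_pos _ _).le h2)

lemma integrable_stft_mul_stft (ψ φ : 𝓢(Eucl d, ℂ)) :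
    Integrable (fun s : (Eucl d × Eucl d) × (Eucl d × Eucl d) =>
      (starRingEnd ℂ) (stft ψ s.1) * stft φ s.2) :=
  (integrable_conj (integrable_stft ψ)).mul_prod (integrable_stft φ)

/-- The expansion of the Wigner function in coherent states is absolutely convergent, jointly with
the phase space variable. -/
lemma integrable_wigner_expansion (ψ φ : 𝓢(Eucl d, ℂ)) :
    Integrable (fun t : ((Eucl d × Eucl d) × (Eucl d × Eucl d)) × (Eucl d × Eucl d) =>
      ((starRingEnd ℂ) (stft ψ t.1.1) * stft φ t.1.2) * wigner (tf t.1.1) (tf t.1.2) t.2) := by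
  have h1 := (integrable_stft_mul_stft ψ φ).norm.mul_prod
    ((phaseGauss (d := d) (2 * Real.pi) (by positivity)).integrable (μ := volume))
  -- Shearing `p` to `(z + w)/2 - p` turns an integrable product into the dominating function.
  have h2 := integrable_shear (θ := fun s : (Eucl d × Eucl d) × (Eucl d × Eucl d) =>
    (1 / 2 : ℝ) • (s.1 + s.2)) (by fun_prop) h1
  have hm : AEStronglyMeasurable
      (fun t : ((Eucl d × Eucl d) × (Eucl d × Eucl d)) × (Eucl d × Eucl d) =>
        wigner (tf t.1.1) (tf t.1.2) t.2) volume := continuous_wigner_tf.aestronglyMeasurable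
  have hm2 : AEStronglyMeasurable
      (fun t : ((Eucl d × Eucl d) × (Eucl d × Eucl d)) × (Eucl d × Eucl d) =>
        ((starRingEnd ℂ) (stft ψ t.1.1) * stft φ t.1.2)) volume :=
    (integrable_stft_mul_stft ψ φ).aestronglyMeasurable.comp_fst
  refine (h2.const_mul (wignerMass d)).mono' (hm2.mul hm)
    (Filter.Eventually.of_forall fun t => ?_)
  rw [norm_mul, norm_wigner_tf]
  exact le_of_eq (by ring)

/-- The reproducing formula once in each argument; the left one is reached through `conj_wigner`. -/
lemma wigner_expansion (ψ φ : 𝓢(Eucl d, ℂ)) (p : Eucl d × Eucl d) :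
    (windowMass d : ℂ) ^ 2 * wigner ψ φ p = ∫ s : (Eucl d × Eucl d) × (Eucl d × Eucl d),
      ((starRingEnd ℂ) (stft ψ s.1) * stft φ s.2) * wigner (tf s.1) (tf s.2) p := by
  have hI : Integrable (fun s : (Eucl d × Eucl d) × (Eucl d × Eucl d) =>
      ((starRingEnd ℂ) (stft ψ s.1) * stft φ s.2) * wigner (tf s.1) (tf s.2) p) := by
    have hm : AEStronglyMeasurable
      (fun s : (Eucl d × Eucl d) × (Eucl d × Eucl d) => wigner (tf s.1) (tf s.2) p) volume :=
      (continuous_wigner_tf.comp (continuous_id.prodMk continuous_const)).aestronglyMeasurable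
    exact (integrable_stft_mul_stft ψ φ).mul_bdd hm
      (Filter.Eventually.of_forall fun s => norm_wigner_tf_le _ _ _)
  have h1 : ∀ w, windowMass d * wigner ψ (tf w) p =
      ∫ z, (starRingEnd ℂ) (stft ψ z) * wigner (tf z) (tf w) p := by
    intro w
    have := congrArg (starRingEnd ℂ) (wigner_reproducing (integrable_tf w) ψ p)
    rw [← integral_conj, map_mul, conj_wigner, Complex.conj_ofReal] at this
    simp_rw [map_mul, conj_wigner] at this
    exact this
  rw [Measure.volume_eq_prod, integral_prod_symm _ hI, sq, mul_assoc,
    wigner_reproducing (ψ.integrable) φ p, ← integral_const_mul]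
  congr 1; ext w
  rw [mul_left_comm, h1, ← integral_const_mul]
  congr 1; ext z
  ring

lemma integrable_wigner (ψ φ : 𝓢(Eucl d, ℂ)) : Integrable (wigner ψ φ) := by
  have h := (integrable_wigner_expansion ψ φ).integral_prod_right
  simp_rw [← wigner_expansion] at h
  have h0 : (windowMass d : ℂ) ^ 2 ≠ 0 :=
    pow_ne_zero _ (Complex.ofReal_ne_zero.2 (windowMass_pos d).ne')
  convert h.const_mul ((windowMass d : ℂ) ^ 2)⁻¹ using 1
  ext p
  rw [inv_mul_cancel_left₀ h0]

/-- The Weyl form is an absolutely convergent phase space integral against the Wigner function. -/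
lemma weylForm_eq_integral_wigner {b : Eucl d × Eucl d → ℝ} (hb : Continuous b) {B : ℝ}
    (hB : ∀ p, |b p| ≤ B) (ψ φ : 𝓢(Eucl d, ℂ)) :
    weylForm b ψ φ = ∫ p : Eucl d × Eucl d,
      (b (p.1, (2 * Real.pi) • p.2) : ℂ) * wigner ψ φ p := by
  have hI : Integrable (fun p : Eucl d × Eucl d =>
      (b (p.1, (2 * Real.pi) • p.2) : ℂ) * wigner ψ φ p) := by
    refine (integrable_wigner ψ φ).bdd_mul (c := B)
      (Continuous.aestronglyMeasurable (by fun_prop)) (Filter.Eventually.of_forall fun p => ?_)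
    rw [Complex.norm_real]; exact hB _
  rw [Measure.volume_eq_prod, integral_prod_symm _ hI, weylForm]
  -- The substitution `ξ = 2πκ` absorbs the prefactor `(2π)⁻ᵈ`.
  have hscale := fun G : Eucl d → ℂ => Measure.integral_comp_smul volume G (2 * Real.pi)
  simp_rw [finrank_euclideanSpace_fin] at hscale
  have hpos : |((2 * Real.pi) ^ d)⁻¹| = ((2 * Real.pi) ^ d)⁻¹ := abs_of_pos (by positivity)
  rw [← Complex.real_smul, ← hpos, ← hscale]
  congr 1; ext κ
  set H : Eucl d × Eucl d → ℂ := fun p =>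
    Complex.exp (Complex.I * (inner ℝ ((2 * Real.pi) • κ) (p.1 - p.2) : ℝ)) *
        (b ((1 / 2 : ℝ) • (p.1 + p.2), (2 * Real.pi) • κ) : ℂ) *
        (starRingEnd ℂ) (ψ p.1) * φ p.2 with hH
  have hHc : Continuous H := by
    have := ψ.continuous
    have := φ.continuous
    have := Complex.continuous_conj
    fun_prop
  have hHn : ∀ p, ‖H p‖ ≤ B * (‖ψ p.1‖ * ‖φ p.2‖) := by
    intro p
    rw [hH]
    simp only [norm_mul, Complex.norm_real, RCLike.norm_conj]
    rw [mul_comm Complex.I, Complex.norm_exp_ofReal_mul_I, one_mul, mul_assoc]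
    gcongr
    exact hB _
  have hHI : Integrable H := by
    refine ((ψ.integrable.norm.mul_prod φ.integrable.norm).const_mul B).mono'
      hHc.aestronglyMeasurable (Filter.Eventually.of_forall hHn)
  rw [Measure.volume_eq_prod, integral_prod_symm _ hHI]
  -- Substituting `x = 2m - y` makes the midpoint `m` the variable; the Jacobian is the `2 ^ d` in
  -- `wigner`.
  have hsub : ∀ y, ∫ x, H (x, y) = 2 ^ d * ∫ m, H ((2 : ℝ) • m - y, y) := by
    intro y
    have h2 := Measure.integral_comp_smul volume (fun x => H (x - y, y)) (2 : ℝ)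
    rw [finrank_euclideanSpace_fin, abs_of_pos (by positivity), Complex.real_smul,
      integral_sub_right_eq_self (fun x => H (x, y)) y] at h2
    rw [h2]; push_cast
    rw [mul_inv_cancel_left₀ (pow_ne_zero _ two_ne_zero)]
  simp_rw [hsub]
  rw [integral_const_mul, integral_integral_swap, ← integral_const_mul]
  · refine integral_congr_ae (Filter.Eventually.of_forall fun m => ?_)
    simp only
    rw [wigner, mul_left_comm]
    congr 1
    rw [← integral_const_mul]
    refine integral_congr_ae (Filter.Eventually.of_forall fun y => ?_)
    simp only [hH]
    have e1 : (1 / 2 : ℝ) • ((2 : ℝ) • m - y + y) = m := by module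
    have e2 : Complex.exp (Complex.I * (inner ℝ ((2 * Real.pi) • κ) ((2 : ℝ) • m - y - y) : ℝ)) =
        osc (4 * Real.pi * inner ℝ (m - y) κ) := by
      rw [osc, mul_comm Complex.I]
      congr 3
      rw [show (2 : ℝ) • m - y - y = (2 : ℝ) • (m - y) by module, inner_smul_left, inner_smul_right,
        real_inner_comm, RCLike.conj_to_real]
      ring
    rw [e1, e2]; ring
  -- Fubini needs `‖ψ(2m - y)‖ ‖φ y‖` integrable in `(y, m)`: it is a product in `y` and `u = y/2 -
  -- m`, since `2m - y = -2u`.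
  · have h3 : Integrable (fun u : Eucl d => ψ ((-2 : ℝ) • u)) :=
      ψ.integrable.comp_smul (by norm_num)
    have h4 := integrable_shear (θ := fun y : Eucl d => (1 / 2 : ℝ) • y) (by fun_prop)
      (φ.integrable (μ := volume).norm.mul_prod h3.norm)
    refine (h4.const_mul B).mono' (Continuous.aestronglyMeasurable (by
      unfold Function.uncurry; fun_prop)) (Filter.Eventually.of_forall fun p => ?_)
    refine (hHn _).trans (le_of_eq ?_)
    rw [show (-2 : ℝ) • ((1 / 2 : ℝ) • p.1 - p.2) = (2 : ℝ) • p.2 - p.1 by module]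
    ring

end

section

/-! ### The Calderón–Vaillancourt estimate -/

/-- `f` is smooth and its derivatives of order at most `N` are bounded by `B`. -/
structure DerivBound {V F : Type*} [NormedAddCommGroup V] [NormedSpace ℝ V] [NormedAddCommGroup F]
    [NormedSpace ℝ F] (N : ℕ) (B : ℝ) (f : V → F) : Prop where
  smooth : ContDiff ℝ ∞ f
  bounded : ∀ n ≤ N, ∀ x, ‖iteratedFDeriv ℝ n f x‖ ≤ B

namespace DerivBound
variable {V W F : Type*} [NormedAddCommGroup V] [NormedSpace ℝ V] [NormedAddCommGroup W]
  [NormedSpace ℝ W] [NormedAddCommGroup F] [NormedSpace ℝ F] {N : ℕ} {B : ℝ} {f : V → F}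

lemma nonneg (h : DerivBound N B f) : 0 ≤ B := (norm_nonneg _).trans (h.bounded 0 (Nat.zero_le _) 0)

lemma norm_le (h : DerivBound N B f) (x : V) : ‖f x‖ ≤ B := by
  simpa using h.bounded 0 (Nat.zero_le _) x

lemma mono (h : DerivBound N B f) {M : ℕ} (hM : M ≤ N) {B' : ℝ} (hB : B ≤ B') :
    DerivBound M B' f :=
  ⟨h.smooth, fun n hn x => (h.bounded n (hn.trans hM) x).trans hB⟩

lemma comp_add (h : DerivBound N B f) (v : V) : DerivBound N B (fun x => f (x + v)) :=
  ⟨h.smooth.comp (contDiff_id.add contDiff_const), fun n hn x => by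
    rw [iteratedFDeriv_comp_add_right]; exact h.bounded n hn _⟩

lemma comp_linear (h : DerivBound N B f) (L : W →L[ℝ] V) {K : ℝ} (hK : 1 ≤ K) (hL : ‖L‖ ≤ K) :
    DerivBound N (B * K ^ N) (fun x => f (L x)) := by
  refine ⟨h.smooth.comp L.contDiff, fun n hn x => ?_⟩
  have hB := h.nonneg
  have e : iteratedFDeriv ℝ n (fun x => f (L x)) x = _ :=
    L.iteratedFDeriv_comp_right h.smooth x (i := n) (mod_cast le_top)
  rw [e]
  refine (ContinuousMultilinearMap.norm_compContinuousLinearMap_le _ _).trans ?_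
  rw [Finset.prod_const, Finset.card_univ, Fintype.card_fin]
  gcongr
  · exact h.bounded n hn _
  · calc ‖L‖ ^ n ≤ K ^ n := by gcongr
      _ ≤ K ^ N := pow_le_pow_right₀ hK hn

end DerivBound

variable {d : ℕ}

/-- The number of derivatives entering the Calderón–Vaillancourt estimate. -/
def cvOrder (d : ℕ) : ℕ := 2 * d + 1

/-- Phase space has dimension `2d`; this integrability requirement is what sets `cvOrder d = 2d +
1`. -/
lemma integrable_wt_phase : Integrable (wt (cvOrder d) : Eucl d × Eucl d → ℝ) :=
  integrable_wt _ (by rw [cvOrder, Module.finrank_prod, finrank_euclideanSpace_fin]; omega)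

/-- The symplectic form on phase space. -/
def symplectic (d : ℕ) : (Eucl d × Eucl d) →L[ℝ] (Eucl d × Eucl d) →L[ℝ] ℝ :=
  (innerSL ℝ).bilinearComp (ContinuousLinearMap.snd ℝ _ _) (ContinuousLinearMap.fst ℝ _ _) -
  (innerSL ℝ).bilinearComp (ContinuousLinearMap.fst ℝ _ _) (ContinuousLinearMap.snd ℝ _ _)

lemma symplectic_apply (p ζ : Eucl d × Eucl d) :
    symplectic d p ζ = inner ℝ p.2 ζ.1 - inner ℝ p.1 ζ.2 := rfl

/-- A constant controlling the derivatives of a bounded function times a Gaussian. -/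
def gaussDerivMass (d n : ℕ) : ℝ := ∑ i ∈ Finset.range (n + 1), (n.choose i : ℝ) *
  ∫ p, ‖iteratedFDeriv ℝ (n - i) (phaseGauss (d := d) (2 * Real.pi) (by positivity)) p‖

lemma gaussDerivMass_nonneg (d n : ℕ) : 0 ≤ gaussDerivMass d n :=
  Finset.sum_nonneg fun _ _ => mul_nonneg (by positivity) (integral_nonneg fun _ => norm_nonneg _)

/-- A Gaussian localisation of a symbol. -/
def localized (b : Eucl d × Eucl d → ℝ) (p : Eucl d × Eucl d) : ℂ :=
  ((b p * phaseGauss (2 * Real.pi) (by positivity) p : ℝ) : ℂ)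

lemma contDiff_localized {N : ℕ} {B : ℝ} {b : Eucl d × Eucl d → ℝ} (hb : DerivBound N B b) :
    ContDiff ℝ ∞ (localized b) :=
  Complex.ofRealCLM.contDiff.comp (hb.smooth.mul (SchwartzMap.smooth _ ⊤))

lemma norm_iteratedFDeriv_localized_le {N : ℕ} {B : ℝ} {b : Eucl d × Eucl d → ℝ}
    (hb : DerivBound N B b) {n : ℕ} (hn : n ≤ N) (p : Eucl d × Eucl d) :
    ‖iteratedFDeriv ℝ n (localized b) p‖ ≤ B * ∑ i ∈ Finset.range (n + 1), (n.choose i : ℝ) *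
      ‖iteratedFDeriv ℝ (n - i) (phaseGauss (d := d) (2 * Real.pi) (by positivity)) p‖ := by
  have h1 : ‖iteratedFDeriv ℝ n (localized b) p‖ = ‖iteratedFDeriv ℝ n (fun p => b p *
      phaseGauss (d := d) (2 * Real.pi) (by positivity) p) p‖ :=
    Complex.ofRealLI.norm_iteratedFDeriv_comp_left
      (hb.smooth.mul (SchwartzMap.smooth _ ⊤)).contDiffAt (mod_cast le_top)
  rw [h1, Finset.mul_sum]
  refine (norm_iteratedFDeriv_mul_le hb.smooth (SchwartzMap.smooth _ ⊤) p (n := n)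
    (mod_cast le_top)).trans (Finset.sum_le_sum fun i hi => ?_)
  have hi' : i ≤ N := (Nat.lt_succ_iff.1 (Finset.mem_range.1 hi)).trans hn
  have := hb.bounded i hi' p
  calc _ ≤ (n.choose i : ℝ) * B *
        ‖iteratedFDeriv ℝ (n - i) (phaseGauss (d := d) (2 * Real.pi) (by positivity)) p‖ := by
        gcongr
    _ = _ := by ring

lemma integrable_sum_iteratedFDeriv_phaseGauss (n : ℕ) :
    Integrable (fun p => ∑ i ∈ Finset.range (n + 1), (n.choose i : ℝ) *
      ‖iteratedFDeriv ℝ (n - i) (phaseGauss (d := d) (2 * Real.pi) (by positivity)) p‖) := by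
  refine integrable_finsetSum _ fun i _ => Integrable.const_mul ?_ _
  simpa using SchwartzMap.integrable_pow_mul_iteratedFDeriv volume
    (phaseGauss (d := d) (2 * Real.pi) (by positivity)) 0 (n - i)

lemma integrable_iteratedFDeriv_localized {N : ℕ} {B : ℝ} {b : Eucl d × Eucl d → ℝ}
    (hb : DerivBound N B b) {n : ℕ} (hn : n ≤ N) :
    Integrable (fun p => ‖iteratedFDeriv ℝ n (localized b) p‖) := by
  refine ((integrable_sum_iteratedFDeriv_phaseGauss n).const_mul B).mono'
    ((contDiff_localized hb).continuous_iteratedFDeriv (mod_cast le_top)).norm.aestronglyMeasurable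
    (Filter.Eventually.of_forall fun p => ?_)
  rw [norm_norm]
  exact norm_iteratedFDeriv_localized_le hb hn p

lemma integral_iteratedFDeriv_localized_le {N : ℕ} {B : ℝ} {b : Eucl d × Eucl d → ℝ}
    (hb : DerivBound N B b) {n : ℕ} (hn : n ≤ N) :
    ∫ p, ‖iteratedFDeriv ℝ n (localized b) p‖ ≤ B * gaussDerivMass d n := by
  refine (integral_mono (integrable_iteratedFDeriv_localized hb hn)
    ((integrable_sum_iteratedFDeriv_phaseGauss n).const_mul B)
    (norm_iteratedFDeriv_localized_le hb hn)).trans (le_of_eq ?_)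
  rw [integral_const_mul, integral_finsetSum]
  · simp_rw [integral_const_mul]; rfl
  · intro i _
    refine Integrable.const_mul ?_ _
    simpa using SchwartzMap.integrable_pow_mul_iteratedFDeriv volume
      (phaseGauss (d := d) (2 * Real.pi) (by positivity)) 0 (n - i)

/-- The symplectic Fourier transform of a localised symbol. -/
def symplecticFourier (f : Eucl d × Eucl d → ℂ) (ζ : Eucl d × Eucl d) : ℂ :=
  ∫ p, osc (2 * Real.pi * (inner ℝ p.1 ζ.2 - inner ℝ p.2 ζ.1)) * f p

lemma symplecticFourier_eq (f : Eucl d × Eucl d → ℂ) (ζ : Eucl d × Eucl d) :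
    symplecticFourier f ζ =
      VectorFourier.fourierIntegral Real.fourierChar volume (symplectic d).toLinearMap₁₂ f ζ := by
  rw [symplecticFourier, VectorFourier.fourierIntegral]
  congr 1; ext p
  rw [Circle.smul_def, Real.fourierChar_apply, smul_eq_mul, osc]
  have : -((symplectic d).toLinearMap₁₂ p) ζ = inner ℝ p.1 ζ.2 - inner ℝ p.2 ζ.1 := by
    change -(symplectic d p ζ) = _
    rw [symplectic_apply]; ring
  rw [this]

/-- Integrate by parts `n` times along `(-ζ.2, ζ.1)`. This direction has norm `‖ζ‖`, and its
symplectic pairing with `ζ` is `‖ζ.1‖² + ‖ζ.2‖² ≥ ‖ζ‖²`, so one factor `‖ζ‖ⁿ` cancels. Only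
derivatives of the symbol up to order `n` enter. -/
lemma pow_mul_norm_symplecticFourier_le {N : ℕ} {B : ℝ} {b : Eucl d × Eucl d → ℝ}
    (hb : DerivBound N B b) {n : ℕ} (hn : n ≤ N) (ζ : Eucl d × Eucl d) :
    ‖ζ‖ ^ n * ‖symplecticFourier (localized b) ζ‖ ≤
      2 ^ n * ∑ j ∈ Finset.range (n + 1), B * gaussDerivMass d j := by
  set S := ∑ j ∈ Finset.range (n + 1), B * gaussDerivMass d j
  have hS : 0 ≤ S :=
    Finset.sum_nonneg fun j _ => mul_nonneg hb.nonneg (gaussDerivMass_nonneg d j)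
  have h := VectorFourier.pow_mul_norm_iteratedFDeriv_fourierIntegral_le (symplectic d)
    (μ := volume) (f := localized b) (K := 0) (N := (N : ℕ∞))
    ((contDiff_localized hb).of_le (mod_cast le_top)) (fun k m hk hm => by
      have hk0 : k = 0 := by simpa using hk
      subst hk0
      simpa using integrable_iteratedFDeriv_localized hb (by exact_mod_cast hm)) (k := 0) (n := n)
      le_rfl (by exact_mod_cast hn) (-ζ.2, ζ.1) ζ
  rw [norm_iteratedFDeriv_zero, ← symplecticFourier_eq, symplectic_apply] at h
  have hv : ‖((-ζ.2, ζ.1) : Eucl d × Eucl d)‖ = ‖ζ‖ := by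
    rw [Prod.norm_mk, Prod.norm_def, norm_neg, max_comm]
  have hL : ‖ζ‖ ^ 2 ≤ |inner ℝ ζ.1 ζ.1 - inner ℝ (-ζ.2) ζ.2| := by
    rw [inner_neg_left, sub_neg_eq_add, real_inner_self_eq_norm_sq, real_inner_self_eq_norm_sq,
      abs_of_nonneg (by positivity)]
    rcases max_cases ‖ζ.1‖ ‖ζ.2‖ with h | h <;> rw [Prod.norm_def, h.1] <;> nlinarith
  have h2 : ‖ζ‖ ^ n * (‖ζ‖ ^ n * ‖symplecticFourier (localized b) ζ‖) ≤ ‖ζ‖ ^ n * (2 ^ n * S) := by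
    calc _ = (‖ζ‖ ^ 2) ^ n * ‖symplecticFourier (localized b) ζ‖ := by
          rw [← pow_mul, two_mul, pow_add]; ring
      _ ≤ _ := by gcongr
      _ ≤ _ := h
      _ ≤ _ := by
        rw [hv]
        simp only [pow_zero, mul_one, Nat.cast_zero, mul_zero, zero_add, Finset.range_one]
        rw [mul_assoc, Finset.sum_product]
        simp only [Finset.sum_singleton, pow_zero, one_mul]
        refine mul_le_mul_of_nonneg_left (mul_le_mul_of_nonneg_left
          (Finset.sum_le_sum fun j hj => ?_) (by positivity)) (by positivity)
        exact integral_iteratedFDeriv_localized_le hb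
          ((Nat.lt_succ_iff.1 (Finset.mem_range.1 hj)).trans hn)
  rcases eq_or_ne (‖ζ‖ ^ n) 0 with h0 | h0
  · rw [h0, zero_mul]; positivity
  · exact le_of_mul_le_mul_left h2 (lt_of_le_of_ne (by positivity) h0.symm)

/-- The constant in `norm_symplecticFourier_le`. -/
def decayConst (d : ℕ) : ℝ := 2 ^ cvOrder d * (gaussDerivMass d 0 +
  2 ^ cvOrder d * ∑ j ∈ Finset.range (cvOrder d + 1), gaussDerivMass d j)

lemma decayConst_nonneg (d : ℕ) : 0 ≤ decayConst d := by
  have := gaussDerivMass_nonneg d 0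
  have : 0 ≤ ∑ j ∈ Finset.range (cvOrder d + 1), gaussDerivMass d j :=
    Finset.sum_nonneg fun j _ => gaussDerivMass_nonneg d j
  unfold decayConst; positivity

lemma norm_symplecticFourier_le {B : ℝ} {b : Eucl d × Eucl d → ℝ}
    (hb : DerivBound (cvOrder d) B b) (ζ : Eucl d × Eucl d) :
    ‖symplecticFourier (localized b) ζ‖ ≤ decayConst d * B * wt (cvOrder d) ζ := by
  have h0 := pow_mul_norm_symplecticFourier_le hb (Nat.zero_le _) ζ
  have h1 := pow_mul_norm_symplecticFourier_le hb le_rfl ζ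
  rw [pow_zero, one_mul] at h0
  refine (le_wt_of_pow_mul_le h0 h1 (norm_nonneg _)).trans (le_of_eq ?_)
  rw [← Finset.mul_sum, ← Finset.mul_sum, decayConst, zero_add, Finset.sum_range_one, pow_zero]
  ring

/-- Matrix elements between coherent states decay off the diagonal. -/
lemma norm_integral_mul_wigner_tf_le {B : ℝ} {b : Eucl d × Eucl d → ℝ}
    (hb : DerivBound (cvOrder d) B b) (z w : Eucl d × Eucl d) :
    ‖∫ p, (b p : ℂ) * wigner (tf z) (tf w) p‖ ≤
      wignerMass d * decayConst d * B * wt (cvOrder d) (z - w) := by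
  set c := (1 / 2 : ℝ) • (z + w) with hc
  -- Centred at the midpoint, the matrix element is a constant phase times the symplectic Fourier
  -- transform, at `w - z`, of a translate of `b` localised at the origin. Translates share the
  -- derivative bounds, so the decay is uniform in the midpoint.
  have h1 : ∫ p, (b p : ℂ) * wigner (tf z) (tf w) p =
      (wignerMass d * osc (2 * Real.pi * inner ℝ c.1 (w.2 - z.2))) *
        symplecticFourier (localized (fun p => b (p + c))) (w - z) := by
    rw [← integral_add_right_eq_self _ c, symplecticFourier, ← integral_const_mul]
    congr 1; ext p
    rw [wigner_tf, localized, ← hc, add_sub_cancel_right]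
    have e : 2 * Real.pi * (inner ℝ (z.1 - w.1) ((p + c).2 - (1 / 2 : ℝ) • (z.2 + w.2)) +
        inner ℝ (p + c).1 (w.2 - z.2)) = 2 * Real.pi * inner ℝ c.1 (w.2 - z.2) +
        2 * Real.pi * (inner ℝ p.1 (w - z).2 - inner ℝ p.2 (w - z).1) := by
      have e1 : (p + c).2 - (1 / 2 : ℝ) • (z.2 + w.2) = p.2 := by
        rw [Prod.snd_add, hc]; simp
      rw [e1, Prod.fst_add, inner_add_left, Prod.fst_sub, Prod.snd_sub, real_inner_comm p.2,
        ← neg_sub w.1 z.1, inner_neg_right]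
      ring
    rw [e, osc_add]
    push_cast
    ring
  rw [h1, norm_mul, norm_mul, norm_osc, mul_one, Complex.norm_real,
    Real.norm_of_nonneg (wignerMass_pos d).le]
  have h2 := norm_symplecticFourier_le (hb.comp_add c) (w - z)
  have h3 : wt (cvOrder d) (w - z) = wt (cvOrder d) (z - w) := by
    unfold wt; rw [norm_sub_rev]
  rw [h3] at h2
  have := (wignerMass_pos d).le
  calc _ ≤ wignerMass d * (decayConst d * B * wt (cvOrder d) (z - w)) := by gcongr
    _ = _ := by ring

/-- Rewrites the form as an integral kernel between short-time Fourier transforms, ready for the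
Schur test. -/
lemma integral_mul_wigner_eq {b : Eucl d × Eucl d → ℝ} (hb : Continuous b) {B : ℝ}
    (hB : ∀ p, |b p| ≤ B) (ψ φ : 𝓢(Eucl d, ℂ)) :
    (windowMass d : ℂ) ^ 2 * ∫ p, (b p : ℂ) * wigner ψ φ p =
      ∫ s : (Eucl d × Eucl d) × (Eucl d × Eucl d),
        ((starRingEnd ℂ) (stft ψ s.1) * stft φ s.2) *
          ∫ p, (b p : ℂ) * wigner (tf s.1) (tf s.2) p := by
  have hI := integrable_wigner_expansion ψ φ
  have hm : AEStronglyMeasurable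
      (fun t : ((Eucl d × Eucl d) × (Eucl d × Eucl d)) × (Eucl d × Eucl d) => (b t.2 : ℂ))
      volume := Continuous.aestronglyMeasurable (by fun_prop)
  have hI2 : Integrable (fun t : ((Eucl d × Eucl d) × (Eucl d × Eucl d)) × (Eucl d × Eucl d) =>
      (b t.2 : ℂ) * (((starRingEnd ℂ) (stft ψ t.1.1) * stft φ t.1.2) *
        wigner (tf t.1.1) (tf t.1.2) t.2)) :=
    hI.bdd_mul (c := B) hm (Filter.Eventually.of_forall fun t => by
      rw [Complex.norm_real]; exact hB _)
  have e1 : ∀ s : (Eucl d × Eucl d) × (Eucl d × Eucl d),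
      ((starRingEnd ℂ) (stft ψ s.1) * stft φ s.2) *
          ∫ p, (b p : ℂ) * wigner (tf s.1) (tf s.2) p =
      ∫ p, (b p : ℂ) * (((starRingEnd ℂ) (stft ψ s.1) * stft φ s.2) *
        wigner (tf s.1) (tf s.2) p) := by
    intro s
    rw [← integral_const_mul]
    congr 1; ext p; ring
  simp_rw [e1]
  rw [integral_integral_swap hI2, ← integral_const_mul]
  congr 1; ext p
  rw [integral_const_mul, ← wigner_expansion]
  ring

/-- A weighted Schur test. -/
lemma integral_schur_le (ψ φ : 𝓢(Eucl d, ℂ)) {l : ℝ} (hl : 0 < l) :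
    Integrable (fun s : (Eucl d × Eucl d) × (Eucl d × Eucl d) =>
      ‖stft ψ s.1‖ * ‖stft φ s.2‖ * wt (cvOrder d) (s.1 - s.2)) ∧
    ∫ s : (Eucl d × Eucl d) × (Eucl d × Eucl d),
      ‖stft ψ s.1‖ * ‖stft φ s.2‖ * wt (cvOrder d) (s.1 - s.2) ≤
    (∫ ζ : Eucl d × Eucl d, wt (cvOrder d) ζ) * windowMass d *
      ((l * ∫ x, ‖ψ x‖ ^ 2) + l⁻¹ * ∫ x, ‖φ x‖ ^ 2) / 2 := by
  have hshear : ∀ θ : 𝓢(Eucl d, ℂ),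
      Integrable (fun s : (Eucl d × Eucl d) × (Eucl d × Eucl d) =>
        ‖stft θ s.1‖ ^ 2 * wt (cvOrder d) (s.1 - s.2)) := fun θ =>
    integrable_shear measurable_id ((integrable_norm_sq_stft θ).mul_prod integrable_wt_phase)
  have hint : ∀ θ : 𝓢(Eucl d, ℂ), ∫ s : (Eucl d × Eucl d) × (Eucl d × Eucl d),
      ‖stft θ s.1‖ ^ 2 * wt (cvOrder d) (s.1 - s.2) =
      (∫ ζ : Eucl d × Eucl d, wt (cvOrder d) ζ) * windowMass d * ∫ x, ‖θ x‖ ^ 2 := by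
    intro θ
    rw [Measure.volume_eq_prod, integral_prod _ (hshear θ)]
    simp_rw [integral_const_mul]
    have : ∀ z : Eucl d × Eucl d, ∫ w : Eucl d × Eucl d, wt (cvOrder d) (z - w) =
        ∫ ζ : Eucl d × Eucl d, wt (cvOrder d) ζ := fun z =>
      integral_sub_left_eq_self (fun w : Eucl d × Eucl d => wt (cvOrder d) w) volume z
    simp_rw [this]
    rw [integral_mul_const, integral_norm_sq_stft]
    ring
  have hswapI : Integrable (fun s : (Eucl d × Eucl d) × (Eucl d × Eucl d) =>
      ‖stft φ s.2‖ ^ 2 * wt (cvOrder d) (s.1 - s.2)) := by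
    refine (hshear φ).swap.congr (Filter.Eventually.of_forall fun s => ?_)
    simp only [Function.comp, Prod.fst_swap, Prod.snd_swap, wt, norm_sub_rev s.2 s.1]
  have hswap : ∫ s : (Eucl d × Eucl d) × (Eucl d × Eucl d),
      ‖stft φ s.2‖ ^ 2 * wt (cvOrder d) (s.1 - s.2) =
      (∫ ζ : Eucl d × Eucl d, wt (cvOrder d) ζ) * windowMass d * ∫ x, ‖φ x‖ ^ 2 := by
    rw [← hint φ, Measure.volume_eq_prod, ← integral_prod_swap]
    congr 1; ext s
    simp only [Prod.fst_swap, Prod.snd_swap, wt, norm_sub_rev s.2 s.1]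
  have hdom : Integrable (fun s : (Eucl d × Eucl d) × (Eucl d × Eucl d) =>
      l / 2 * (‖stft ψ s.1‖ ^ 2 * wt (cvOrder d) (s.1 - s.2)) +
      l⁻¹ / 2 * (‖stft φ s.2‖ ^ 2 * wt (cvOrder d) (s.1 - s.2))) :=
    ((hshear ψ).const_mul _).add (hswapI.const_mul _)
  have hpt : ∀ s : (Eucl d × Eucl d) × (Eucl d × Eucl d),
      ‖stft ψ s.1‖ * ‖stft φ s.2‖ * wt (cvOrder d) (s.1 - s.2) ≤
      l / 2 * (‖stft ψ s.1‖ ^ 2 * wt (cvOrder d) (s.1 - s.2)) +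
      l⁻¹ / 2 * (‖stft φ s.2‖ ^ 2 * wt (cvOrder d) (s.1 - s.2)) := by
    intro s
    have hw := (wt_pos (cvOrder d) (s.1 - s.2)).le
    -- Weighted arithmetic-geometric mean; `l` stays free so that optimising it later restores the
    -- product of the two norms.
    have h : ‖stft ψ s.1‖ * ‖stft φ s.2‖ ≤
        l / 2 * ‖stft ψ s.1‖ ^ 2 + l⁻¹ / 2 * ‖stft φ s.2‖ ^ 2 := by
      have := mul_nonneg (inv_pos.2 hl).le (sq_nonneg (l * ‖stft ψ s.1‖ - ‖stft φ s.2‖))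
      have e : l⁻¹ * (l * ‖stft ψ s.1‖ - ‖stft φ s.2‖) ^ 2 = l * ‖stft ψ s.1‖ ^ 2 -
          2 * (‖stft ψ s.1‖ * ‖stft φ s.2‖) + l⁻¹ * ‖stft φ s.2‖ ^ 2 := by
        field_simp; ring
      linarith
    calc _ ≤ (l / 2 * ‖stft ψ s.1‖ ^ 2 + l⁻¹ / 2 * ‖stft φ s.2‖ ^ 2) *
          wt (cvOrder d) (s.1 - s.2) := by gcongr
      _ = _ := by ring
  have hI : Integrable (fun s : (Eucl d × Eucl d) × (Eucl d × Eucl d) =>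
      ‖stft ψ s.1‖ * ‖stft φ s.2‖ * wt (cvOrder d) (s.1 - s.2)) := by
    have hm : AEStronglyMeasurable (fun s : (Eucl d × Eucl d) × (Eucl d × Eucl d) =>
        wt (cvOrder d) (s.1 - s.2)) volume := Continuous.aestronglyMeasurable (by fun_prop)
    refine hdom.mono' ((((integrable_stft ψ).norm.mul_prod
      (integrable_stft φ).norm).aestronglyMeasurable).mul hm)
      (Filter.Eventually.of_forall fun s => ?_)
    have hw := (wt_pos (cvOrder d) (s.1 - s.2)).le
    rw [Real.norm_of_nonneg (by positivity)]
    exact hpt s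
  refine ⟨hI, (integral_mono hI hdom hpt).trans (le_of_eq ?_)⟩
  rw [integral_add ((hshear ψ).const_mul _) (hswapI.const_mul _), integral_const_mul,
    integral_const_mul, hint, hswap]
  ring

/-- The constant of the Calderón–Vaillancourt estimate. -/
def cvConst (d : ℕ) : ℝ := wignerMass d * decayConst d * (2 * Real.pi) ^ cvOrder d *
  (∫ ζ : Eucl d × Eucl d, wt (cvOrder d) ζ) / windowMass d

lemma cvConst_nonneg (d : ℕ) : 0 ≤ cvConst d := by
  have := (wignerMass_pos d).le
  have := decayConst_nonneg d
  have := (windowMass_pos d).le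
  have : 0 ≤ ∫ ζ : Eucl d × Eucl d, wt (cvOrder d) ζ := integral_nonneg fun ζ => (wt_pos _ ζ).le
  unfold cvConst; positivity

lemma derivBound_rescale {N : ℕ} {B : ℝ} {b : Eucl d × Eucl d → ℝ} (hb : DerivBound N B b) :
    DerivBound N (B * (2 * Real.pi) ^ N) (fun p : Eucl d × Eucl d => b (p.1, (2 * Real.pi) • p.2)) := by
  have h1 : (1 : ℝ) ≤ 2 * Real.pi := by linarith [Real.pi_gt_three]
  refine hb.comp_linear ((ContinuousLinearMap.fst ℝ (Eucl d) (Eucl d)).prod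
    ((2 * Real.pi) • ContinuousLinearMap.snd ℝ (Eucl d) (Eucl d))) h1 ?_
  refine ContinuousLinearMap.opNorm_le_bound _ (by positivity) fun p => ?_
  change ‖(p.1, (2 * Real.pi) • p.2)‖ ≤ _
  rw [Prod.norm_mk, norm_smul, Real.norm_of_nonneg (by positivity)]
  refine max_le ?_ ?_
  · calc ‖p.1‖ ≤ ‖p‖ := norm_fst_le p
      _ ≤ _ := le_mul_of_one_le_left (norm_nonneg _) h1
  · gcongr; exact norm_snd_le p

/-- The kernel between coherent states is dominated by a convolution weight in `s.1 - s.2`, to which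
the Schur test applies. One of the two factors `windowMass` is used up by the `L²` identity for
`stft`. -/
lemma norm_weylForm_le_weighted {B : ℝ} {b : Eucl d × Eucl d → ℝ}
    (hb : DerivBound (cvOrder d) B b) (ψ φ : 𝓢(Eucl d, ℂ)) {l : ℝ} (hl : 0 < l) :
    ‖weylForm b ψ φ‖ ≤ cvConst d * B *
      (((l * ∫ x, ‖ψ x‖ ^ 2) + l⁻¹ * ∫ x, ‖φ x‖ ^ 2) / 2) := by
  have hb' := derivBound_rescale hb
  have hw := windowMass_pos d
  rw [weylForm_eq_integral_wigner hb.smooth.continuous hb.norm_le]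
  have h1 := integral_mul_wigner_eq hb'.smooth.continuous hb'.norm_le ψ φ
  have h2 := congrArg norm h1
  rw [norm_mul, norm_pow, Complex.norm_real, Real.norm_of_nonneg hw.le] at h2
  obtain ⟨hS1, hS2⟩ := integral_schur_le ψ φ hl
  set K := wignerMass d * decayConst d * (B * (2 * Real.pi) ^ cvOrder d) with hK
  have hK0 : 0 ≤ K := by
    have := (wignerMass_pos d).le
    have := decayConst_nonneg d
    have := hb.nonneg
    positivity
  have h3 : windowMass d ^ 2 *
      ‖∫ p : Eucl d × Eucl d, (b (p.1, (2 * Real.pi) • p.2) : ℂ) * wigner ψ φ p‖ ≤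
      K * ((∫ ζ : Eucl d × Eucl d, wt (cvOrder d) ζ) * windowMass d *
      ((l * ∫ x, ‖ψ x‖ ^ 2) + l⁻¹ * ∫ x, ‖φ x‖ ^ 2) / 2) := by
    rw [h2]
    refine (norm_integral_le_of_norm_le (hS1.const_mul K)
      (Filter.Eventually.of_forall fun s => ?_)).trans ?_
    · rw [norm_mul, norm_mul, RCLike.norm_conj]
      have := norm_integral_mul_wigner_tf_le hb' s.1 s.2
      calc _ ≤ ‖stft ψ s.1‖ * ‖stft φ s.2‖ * (K * wt (cvOrder d) (s.1 - s.2)) := by gcongr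
        _ = _ := by ring
    · rw [integral_const_mul]
      gcongr
  have h4 : ‖∫ p : Eucl d × Eucl d, (b (p.1, (2 * Real.pi) • p.2) : ℂ) * wigner ψ φ p‖ ≤
      K * ((∫ ζ : Eucl d × Eucl d, wt (cvOrder d) ζ) * windowMass d *
      ((l * ∫ x, ‖ψ x‖ ^ 2) + l⁻¹ * ∫ x, ‖φ x‖ ^ 2) / 2) / windowMass d ^ 2 := by
    rw [le_div_iff₀ (by positivity), mul_comm]; exact h3
  refine h4.trans (le_of_eq ?_)
  rw [hK, cvConst]
  field_simp

lemma integral_norm_sq_eq (φ : 𝓢(Eucl d, ℂ)) :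
    ∫ x, ‖φ x‖ ^ 2 = ‖φ.toLp 2 (volume : Measure (Eucl d))‖ ^ 2 := by
  have h := SchwartzMap.inner_toL2_toL2_eq φ φ (μ := volume)
  rw [inner_self_eq_norm_sq_to_K] at h
  simp_rw [inner_self_eq_norm_sq_to_K] at h
  have h' : ((‖φ.toLp 2 (volume : Measure (Eucl d))‖ ^ 2 : ℝ) : ℂ) =
      ((∫ x, ‖φ x‖ ^ 2 : ℝ) : ℂ) := by
    rw [← integral_complex_ofReal]
    push_cast
    exact h
  exact (Complex.ofReal_injective h').symm

lemma le_mul_of_forall_weighted {x a b : ℝ} (ha : 0 ≤ a) (hb : 0 ≤ b)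
    (h : ∀ l : ℝ, 0 < l → x ≤ (l * a ^ 2 + l⁻¹ * b ^ 2) / 2) : x ≤ a * b := by
  -- The optimal weight is `l = b / a`; adding `e` to both keeps it defined when `a` or `b`
  -- vanishes.
  have key : ∀ e : ℝ, 0 < e → x ≤ (a + e) * (b + e) := by
    intro e he
    have ha' : 0 < a + e := by linarith
    have hb' : 0 < b + e := by linarith
    calc x ≤ ((b + e) / (a + e) * a ^ 2 + ((b + e) / (a + e))⁻¹ * b ^ 2) / 2 := h _ (by positivity)
      _ ≤ ((b + e) / (a + e) * (a + e) ^ 2 + ((b + e) / (a + e))⁻¹ * (b + e) ^ 2) / 2 := by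
          gcongr <;> linarith
      _ = (a + e) * (b + e) := by field_simp; ring
  have hlim : Filter.Tendsto (fun e : ℝ => (a + e) * (b + e)) (nhdsWithin 0 (Set.Ioi 0))
      (nhds ((a + 0) * (b + 0))) :=
    (Continuous.tendsto (by fun_prop) 0).mono_left nhdsWithin_le_nhds
  simp only [add_zero] at hlim
  exact ge_of_tendsto hlim (by filter_upwards [self_mem_nhdsWithin] with e he using key e he)

/-- The Calderón–Vaillancourt estimate for the Weyl form. -/
theorem norm_weylForm_le {B : ℝ} {b : Eucl d × Eucl d → ℝ}
    (hb : DerivBound (cvOrder d) B b) (ψ φ : 𝓢(Eucl d, ℂ)) :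
    ‖weylForm b ψ φ‖ ≤ cvConst d * B *
      (‖ψ.toLp 2 (volume : Measure (Eucl d))‖ * ‖φ.toLp 2 (volume : Measure (Eucl d))‖) := by
  have hc := cvConst_nonneg d
  have hB := hb.nonneg
  have hcB : 0 ≤ cvConst d * B := by positivity
  rcases hcB.eq_or_lt with h0 | h0
  · have := norm_weylForm_le_weighted hb ψ φ one_pos
    rw [← h0, zero_mul] at this ⊢
    exact this
  · rw [mul_comm, ← div_le_iff₀ h0]
    refine le_mul_of_forall_weighted (norm_nonneg _) (norm_nonneg _) fun l hl => ?_
    rw [div_le_iff₀ h0, ← integral_norm_sq_eq, ← integral_norm_sq_eq, mul_comm]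
    exact norm_weylForm_le_weighted hb ψ φ hl

end

section

variable {d : ℕ}

/-! ### Weyl quantization as a bounded operator -/

/-- The inclusion of Schwartz functions into `L²`. -/
abbrev toL2 (d : ℕ) : 𝓢(Eucl d, ℂ) →L[ℂ] L2 d :=
  SchwartzMap.toLpCLM ℂ ℂ 2 (volume : Measure (Eucl d))

lemma denseRange_toL2 : DenseRange (toL2 d) :=
  SchwartzMap.denseRange_toLpCLM (by norm_num)

lemma integrable_wigner_integrand {f : Eucl d → ℂ} (hf : Continuous f) {C : ℝ}
    (hC : ∀ x, ‖f x‖ ≤ C) {h : Eucl d → ℂ} (hh : Integrable h) (p : Eucl d × Eucl d) :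
    Integrable (fun y => osc (4 * Real.pi * inner ℝ (p.1 - y) p.2) *
      (starRingEnd ℂ) (f ((2 : ℝ) • p.1 - y)) * h y) := by
  have := Complex.continuous_conj
  refine hh.bdd_mul (c := C) (Continuous.aestronglyMeasurable (by fun_prop))
    (Filter.Eventually.of_forall fun y => ?_)
  rw [norm_mul, norm_osc, one_mul, RCLike.norm_conj]
  exact hC _

lemma wigner_add_right (ψ φ₁ φ₂ : 𝓢(Eucl d, ℂ)) (p : Eucl d × Eucl d) :
    wigner ψ (φ₁ + φ₂ : 𝓢(Eucl d, ℂ)) p = wigner ψ φ₁ p + wigner ψ φ₂ p := by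
  have hI := fun φ : 𝓢(Eucl d, ℂ) => integrable_wigner_integrand ψ.continuous
    (ψ.norm_le_seminorm ℝ) (φ.integrable (μ := volume)) p
  simp only [wigner]
  rw [← mul_add, ← integral_add (hI φ₁) (hI φ₂)]
  congr 2; ext y
  rw [add_apply, mul_add]

lemma wigner_smul_right (f h : Eucl d → ℂ) (c : ℂ) (p : Eucl d × Eucl d) :
    wigner f (c • h) p = c * wigner f h p := by
  simp only [wigner]
  rw [mul_left_comm]
  congr 1
  rw [← integral_const_mul]
  refine integral_congr_ae (Filter.Eventually.of_forall fun y => ?_)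
  simp only [Pi.smul_apply, smul_eq_mul]; ring

/-! ### Sesquilinearity and hermitian symmetry of the Weyl form. -/

section Form
variable {b : Eucl d × Eucl d → ℝ}

lemma integrable_symbol_mul_wigner (hb : Continuous b) {B : ℝ} (hB : ∀ p, |b p| ≤ B)
    (ψ φ : 𝓢(Eucl d, ℂ)) : Integrable (fun p : Eucl d × Eucl d =>
      (b (p.1, (2 * Real.pi) • p.2) : ℂ) * wigner ψ φ p) := by
  refine (integrable_wigner ψ φ).bdd_mul (c := B)
    (Continuous.aestronglyMeasurable (by fun_prop)) (Filter.Eventually.of_forall fun p => ?_)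
  rw [Complex.norm_real]; exact hB _

lemma weylForm_add_right (hb : Continuous b) {B : ℝ} (hB : ∀ p, |b p| ≤ B)
    (ψ φ₁ φ₂ : 𝓢(Eucl d, ℂ)) :
    weylForm b ψ (φ₁ + φ₂) = weylForm b ψ φ₁ + weylForm b ψ φ₂ := by
  simp only [weylForm_eq_integral_wigner hb hB]
  rw [← integral_add (integrable_symbol_mul_wigner hb hB ψ φ₁)
    (integrable_symbol_mul_wigner hb hB ψ φ₂)]
  congr 1; ext p
  rw [wigner_add_right, mul_add]

lemma weylForm_smul_right (hb : Continuous b) {B : ℝ} (hB : ∀ p, |b p| ≤ B)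
    (ψ φ : 𝓢(Eucl d, ℂ)) (c : ℂ) : weylForm b ψ (c • φ) = c * weylForm b ψ φ := by
  simp only [weylForm_eq_integral_wigner hb hB]
  rw [← integral_const_mul]
  congr 1; ext p
  rw [FunLike.coe_smul, wigner_smul_right, mul_left_comm]

lemma conj_weylForm (hb : Continuous b) {B : ℝ} (hB : ∀ p, |b p| ≤ B) (ψ φ : 𝓢(Eucl d, ℂ)) :
    (starRingEnd ℂ) (weylForm b ψ φ) = weylForm b φ ψ := by
  simp only [weylForm_eq_integral_wigner hb hB]
  rw [← integral_conj]
  congr 1; ext p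
  rw [map_mul, conj_wigner, Complex.conj_ofReal]

end Form

lemma eq_of_inner_toL2 {v w : L2 d} (h : ∀ φ, inner ℂ v (toL2 d φ) = inner ℂ w (toL2 d φ)) :
    v = w := by
  have := denseRange_toL2.equalizer (g := fun x : L2 d => inner ℂ v x)
    (h := fun x : L2 d => inner ℂ w x) (by fun_prop) (by fun_prop) (funext h)
  exact ext_inner_right ℂ fun x => congrFun this x

lemma eq_of_inner_toL2_left {v w : L2 d}
    (h : ∀ φ, inner ℂ (toL2 d φ) v = inner ℂ (toL2 d φ) w) : v = w :=
  eq_of_inner_toL2 fun φ => by rw [← inner_conj_symm, h, inner_conj_symm]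

/-- A Weyl quantization is unique. -/
lemma IsWeylQuantization.unique {b : Eucl d × Eucl d → ℝ} {A A' : L2 d →L[ℂ] L2 d}
    (h : IsWeylQuantization b A) (h' : IsWeylQuantization b A') : A = A' := by
  have := denseRange_toL2.equalizer (g := A) (h := A') A.continuous A'.continuous
    (funext fun φ => eq_of_inner_toL2_left fun ψ => (h ψ φ).trans (h' ψ φ).symm)
  exact ContinuousLinearMap.ext fun x => congrFun this x

/-- A Weyl quantization of a real symbol is self-adjoint. -/
lemma IsWeylQuantization.isSelfAdjoint {b : Eucl d × Eucl d → ℝ} (hb : Continuous b) {B : ℝ}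
    (hB : ∀ p, |b p| ≤ B) {A : L2 d →L[ℂ] L2 d} (h : IsWeylQuantization b A) :
    IsSelfAdjoint A := by
  have h' : IsWeylQuantization b (ContinuousLinearMap.adjoint A) := fun ψ φ => by
    rw [ContinuousLinearMap.adjoint_inner_right, ← inner_conj_symm, h φ ψ, conj_weylForm hb hB]
  exact h'.unique h

/-- Symbols with bounded derivatives have a bounded Weyl quantization. -/
theorem exists_isWeylQuantization {B : ℝ} {b : Eucl d × Eucl d → ℝ}
    (hb : DerivBound (cvOrder d) B b) :
    ∃ A : L2 d →L[ℂ] L2 d, IsWeylQuantization b A ∧ ‖A‖ ≤ cvConst d * B := by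
  have hbc := hb.smooth.continuous
  have hbB : ∀ p, |b p| ≤ B := hb.norm_le
  have hC : 0 ≤ cvConst d * B := mul_nonneg (cvConst_nonneg d) hb.nonneg
  let f : 𝓢(Eucl d, ℂ) → 𝓢(Eucl d, ℂ) →ₗ[ℂ] ℂ := fun ψ =>
    { toFun := fun φ => weylForm b ψ φ
      map_add' := fun φ₁ φ₂ => weylForm_add_right hbc hbB ψ φ₁ φ₂
      map_smul' := fun c φ => weylForm_smul_right hbc hbB ψ φ c }
  have hf : ∀ ψ φ, ‖f ψ φ‖ ≤ (cvConst d * B * ‖toL2 d ψ‖) * ‖(toL2 d).toLinearMap φ‖ := by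
    intro ψ φ
    rw [mul_assoc]
    exact norm_weylForm_le hb ψ φ
  let Λ : 𝓢(Eucl d, ℂ) → L2 d →L[ℂ] ℂ := fun ψ => (f ψ).extendOfNorm (toL2 d).toLinearMap
  have hΛ : ∀ ψ φ, Λ ψ (toL2 d φ) = weylForm b ψ φ := fun ψ φ =>
    LinearMap.extendOfNorm_eq denseRange_toL2 ⟨_, hf ψ⟩ φ
  have hΛn : ∀ ψ, ‖Λ ψ‖ ≤ cvConst d * B * ‖toL2 d ψ‖ := fun ψ =>
    ContinuousLinearMap.opNorm_le_bound _ (by positivity)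
      (LinearMap.norm_extendOfNorm_apply_le denseRange_toL2 _ (hf ψ))
  let v : 𝓢(Eucl d, ℂ) → L2 d := fun ψ => (InnerProductSpace.toDual ℂ (L2 d)).symm (Λ ψ)
  have hv : ∀ ψ φ, inner ℂ (v ψ) (toL2 d φ) = weylForm b ψ φ := fun ψ φ => by
    rw [InnerProductSpace.toDual_symm_apply, hΛ]
  -- Each functional `weylForm b ψ` has a Riesz vector `v ψ`. Hermitian symmetry moves it to the
  -- second slot, so `v` is linear and is already the desired operator on Schwartz functions; it
  -- remains to extend it by density.
  have hv' : ∀ ψ φ, inner ℂ (toL2 d ψ) (v φ) = weylForm b ψ φ := fun ψ φ => by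
    rw [← inner_conj_symm, hv, conj_weylForm hbc hbB]
  let T : 𝓢(Eucl d, ℂ) →ₗ[ℂ] L2 d :=
    { toFun := v
      map_add' := fun φ₁ φ₂ => eq_of_inner_toL2_left fun ψ => by
        rw [inner_add_right, hv', hv', hv', weylForm_add_right hbc hbB]
      map_smul' := fun c φ => eq_of_inner_toL2_left fun ψ => by
        rw [RingHom.id_apply, inner_smul_right, hv', hv', weylForm_smul_right hbc hbB] }
  have hT : ∀ φ, ‖T φ‖ ≤ cvConst d * B * ‖(toL2 d).toLinearMap φ‖ := fun φ => by
    change ‖v φ‖ ≤ _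
    rw [LinearIsometryEquiv.norm_map]
    exact hΛn φ
  refine ⟨T.extendOfNorm (toL2 d).toLinearMap, fun ψ φ => ?_,
    ContinuousLinearMap.opNorm_le_bound _ hC
      (LinearMap.norm_extendOfNorm_apply_le denseRange_toL2 _ hT)⟩
  have : T.extendOfNorm (toL2 d).toLinearMap (toL2 d φ) = v φ :=
    LinearMap.extendOfNorm_eq denseRange_toL2 ⟨_, hT⟩ φ
  change inner ℂ (toL2 d ψ) (T.extendOfNorm (toL2 d).toLinearMap (toL2 d φ)) = _
  rw [this, hv']

/-! ### Spectral edges and quadratic forms -/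

section Edges
variable {H : Type*} [NormedAddCommGroup H] [InnerProductSpace ℂ H] [CompleteSpace H]

/-- Both sides of the form inequality are continuous in the vector, so testing the operator order on
a dense range is enough. -/
lemma le_algebraMap_iff_form {A : H →L[ℂ] H} (hA : IsSelfAdjoint A) {ι : Type*} {e : ι → H}
    (he : DenseRange e) (E : ℝ) :
    A ≤ algebraMap ℝ _ E ↔ ∀ i, (inner ℂ (e i) (A (e i))).re ≤ E * ‖e i‖ ^ 2 := by
  have key : ∀ x : H, (inner ℂ ((algebraMap ℝ (H →L[ℂ] H) E - A) x) x).re =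
      E * ‖x‖ ^ 2 - (inner ℂ x (A x)).re := by
    intro x
    have e1 : (algebraMap ℝ (H →L[ℂ] H) E - A) x = (E : ℂ) • x - A x := by
      rw [Algebra.algebraMap_eq_smul_one]
      rfl
    rw [e1, inner_sub_left, inner_smul_left, Complex.conj_ofReal, inner_self_eq_norm_sq_to_K,
      ← inner_conj_symm (A x), Complex.sub_re, Complex.conj_re]
    simp [← Complex.ofReal_pow]
  rw [ContinuousLinearMap.le_def, ContinuousLinearMap.isPositive_def']
  constructor
  · rintro ⟨-, h⟩ i
    have := h (e i)
    rw [ContinuousLinearMap.reApplyInnerSelf_apply] at this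
    have h2 := key (e i)
    rw [RCLike.re_eq_complex_re] at this
    linarith
  · intro h
    refine ⟨(IsSelfAdjoint.algebraMap _ (IsSelfAdjoint.all E)).sub hA, fun x => ?_⟩
    have hcl : IsClosed {x : H | 0 ≤ E * ‖x‖ ^ 2 - (inner ℂ x (A x)).re} :=
      isClosed_le continuous_const (by fun_prop)
    have hx : x ∈ {x : H | 0 ≤ E * ‖x‖ ^ 2 - (inner ℂ x (A x)).re} :=
      he.induction_on (p := fun x => x ∈ {x : H | 0 ≤ E * ‖x‖ ^ 2 -
        (inner ℂ x (A x)).re}) x hcl (fun i => sub_nonneg.2 (h i))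
    rw [ContinuousLinearMap.reApplyInnerSelf_apply, RCLike.re_eq_complex_re, key]
    exact hx

/-- For self-adjoint `A`, spectrum below `E` is the same as `A ≤ E`. Nontriviality of `H` makes the
spectrum nonempty, so that `sSup` is not its default value. -/
lemma sSup_spectrum_le_iff [Nontrivial H] {A : H →L[ℂ] H} (hA : IsSelfAdjoint A) {ι : Type*}
    {e : ι → H} (he : DenseRange e) (E : ℝ) :
    sSup {t : ℝ | (t : ℂ) ∈ spectrum ℂ A} ≤ E ↔
      ∀ i, (inner ℂ (e i) (A (e i))).re ≤ E * ‖e i‖ ^ 2 := by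
  have h1 : {t : ℝ | (t : ℂ) ∈ spectrum ℂ A} = spectrum ℝ A := by
    rw [← spectrum.preimage_algebraMap ℂ]
    rfl
  rw [h1, ← le_algebraMap_iff_form hA he, le_algebraMap_iff_spectrum_le (ha := hA),
    csSup_le_iff (spectrum.isCompact (𝕜 := ℝ) A).bddAbove
      (ContinuousFunctionalCalculus.spectrum_nonempty A hA)]

end Edges

instance nontrivial_L2 : Nontrivial (L2 d) := by
  let φ : 𝓢(Eucl d, ℂ) := (gaussS 1 one_pos).postcompCLM Complex.ofRealCLM
  have hφ : φ ≠ 0 := fun h => by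
    have h0 : φ 0 = 0 := by rw [h]; rfl
    have h1 : φ 0 = (gauss 1 (0 : Eucl d) : ℂ) := by
      change Complex.ofRealCLM (gaussS 1 one_pos 0) = _
      rw [gaussS_apply]; rfl
    rw [h1] at h0
    exact (gauss_pos 1 (0 : Eucl d)).ne' (by exact_mod_cast h0)
  refine ⟨toL2 d φ, toL2 d 0, fun h => hφ ?_⟩
  exact SchwartzMap.injective_toLp 2 (volume : Measure (Eucl d)) h

/-- The upper spectral edge is the best upper bound of the quadratic form on Schwartz functions. -/
lemma upperEdge_le_iff {A : L2 d →L[ℂ] L2 d} (hA : IsSelfAdjoint A) (E : ℝ) :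
    upperEdge A ≤ E ↔ ∀ φ, (inner ℂ (toL2 d φ) (A (toL2 d φ))).re ≤ E * ‖toL2 d φ‖ ^ 2 :=
  sSup_spectrum_le_iff hA denseRange_toL2 E

lemma lowerEdge_eq (A : L2 d →L[ℂ] L2 d) : lowerEdge A = -upperEdge (-A) := by
  rw [lowerEdge, upperEdge, Real.sInf_def, ← spectrum.neg_eq]
  congr 2
  ext t
  simp

end

section

/-! ### Finite differences of symbols -/

namespace DerivBound
variable {V F : Type*} [NormedAddCommGroup V] [NormedSpace ℝ V] [NormedAddCommGroup F]
  [NormedSpace ℝ F] {N : ℕ} {B : ℝ} {f : V → F}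

/-- The mean value inequality for each iterated derivative: one order of smoothness buys a factor
`‖k‖`. -/
lemma sub_translate (h : DerivBound (N + 1) B f) (k : V) :
    DerivBound N (B * ‖k‖) (fun x => f (x + k) - f x) := by
  have hs : ContDiff ℝ ∞ (fun x => f (x + k)) := (h.comp_add k).smooth
  refine ⟨hs.sub h.smooth, fun n hn x => ?_⟩
  have e : iteratedFDeriv ℝ n (fun x => f (x + k) - f x) x =
      iteratedFDeriv ℝ n f (x + k) - iteratedFDeriv ℝ n f x := by
    have := iteratedFDeriv_sub_apply (i := n) (𝕜 := ℝ) (x := x)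
      (hs.contDiffAt.of_le (mod_cast le_top)) (h.smooth.contDiffAt.of_le (mod_cast le_top))
    rw [← iteratedFDeriv_comp_add_right n k x]
    exact this
  rw [e]
  have hd : Differentiable ℝ (iteratedFDeriv ℝ n f) :=
    h.smooth.differentiable_iteratedFDeriv (mod_cast WithTop.coe_lt_top _)
  have := Convex.norm_image_sub_le_of_norm_fderiv_le (𝕜 := ℝ) (s := Set.univ)
    (f := iteratedFDeriv ℝ n f) (C := B) (fun y _ => hd y)
    (fun y _ => by rw [norm_fderiv_iteratedFDeriv]; exact h.bounded (n + 1) (by omega) y)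
    convex_univ (Set.mem_univ x) (Set.mem_univ (x + k))
  simpa using this

/-- Two first differences, recentred by `-k`. The two orders spent here are the reason for `cvOrder
d + 2` below. -/
lemma second_difference (h : DerivBound (N + 2) B f) (k : V) :
    DerivBound N (B * ‖k‖ ^ 2) (fun x => f (x + k) + f (x - k) - (2 : ℝ) • f x) := by
  have h2 := ((h.sub_translate k).sub_translate k).comp_add (-k)
  rw [mul_assoc, ← sq] at h2
  convert h2 using 2 with x
  rw [neg_add_cancel_right, ← sub_eq_add_neg, two_smul]
  abel

end DerivBound

variable {d : ℕ}

/-! ### Linearity in the symbol and translation covariance. -/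

section Linearity
variable {b b' b'' : Eucl d × Eucl d → ℝ}

lemma weylForm_second_difference (hb : Continuous b) {B : ℝ} (hB : ∀ p, |b p| ≤ B)
    (hb' : Continuous b') (hB' : ∀ p, |b' p| ≤ B) (hb'' : Continuous b'')
    (hB'' : ∀ p, |b'' p| ≤ B) (ψ φ : 𝓢(Eucl d, ℂ)) :
    weylForm (fun p => b p + b' p - (2 : ℝ) • b'' p) ψ φ =
      weylForm b ψ φ + weylForm b' ψ φ - 2 * weylForm b'' ψ φ := by
  have hB4 : ∀ p, |b p + b' p - (2 : ℝ) • b'' p| ≤ 4 * B := fun p => by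
    have h1 := abs_le.1 (hB p)
    have h2 := abs_le.1 (hB' p)
    have h3 := abs_le.1 (hB'' p)
    rw [smul_eq_mul, abs_le]
    constructor <;> linarith
  have h1 := integrable_symbol_mul_wigner hb hB ψ φ
  have h2 := integrable_symbol_mul_wigner hb' hB' ψ φ
  have h3 := (integrable_symbol_mul_wigner hb'' hB'' ψ φ).const_mul 2
  have h12 : Integrable (fun p : Eucl d × Eucl d =>
      (b (p.1, (2 * Real.pi) • p.2) : ℂ) * wigner ψ φ p +
      (b' (p.1, (2 * Real.pi) • p.2) : ℂ) * wigner ψ φ p) := h1.add h2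
  rw [weylForm_eq_integral_wigner (by fun_prop) hB4, weylForm_eq_integral_wigner hb hB,
    weylForm_eq_integral_wigner hb' hB', weylForm_eq_integral_wigner hb'' hB'',
    ← integral_add h1 h2, ← integral_const_mul, ← integral_sub h12 h3]
  congr 1; ext p
  push_cast [smul_eq_mul]
  ring

lemma weylForm_neg (b : Eucl d × Eucl d → ℝ) (ψ φ : 𝓢(Eucl d, ℂ)) :
    weylForm (fun p => -b p) ψ φ = -weylForm b ψ φ := by
  simp only [weylForm]
  rw [← mul_neg, ← integral_neg]
  congr 2; ext ξ
  rw [← integral_neg]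
  congr 1; ext p
  push_cast; ring

/-- Weyl quantization is covariant under translations in position. -/
lemma weylForm_translate (b : Eucl d × Eucl d → ℝ) (s : Eucl d) (ψ φ : 𝓢(Eucl d, ℂ)) :
    weylForm (fun p => b (p.1 + s, p.2)) ψ φ =
      weylForm b (SchwartzMap.compSubConstCLM ℂ s ψ) (SchwartzMap.compSubConstCLM ℂ s φ) := by
  simp only [weylForm]
  congr 2; ext ξ
  symm
  rw [← integral_add_right_eq_self _ ((s, s) : Eucl d × Eucl d)]
  congr 1; ext p
  simp only [SchwartzMap.compSubConstCLM_apply, Prod.fst_add, Prod.snd_add, add_sub_cancel_right,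
    add_sub_add_right_eq_sub]
  rw [show (1 / 2 : ℝ) • (p.1 + s + (p.2 + s)) = (1 / 2 : ℝ) • (p.1 + p.2) + s by module]

lemma norm_toL2_translate (s : Eucl d) (φ : 𝓢(Eucl d, ℂ)) :
    ‖toL2 d (SchwartzMap.compSubConstCLM ℂ s φ)‖ = ‖toL2 d φ‖ := by
  have h : ‖toL2 d (SchwartzMap.compSubConstCLM ℂ s φ)‖ ^ 2 = ‖toL2 d φ‖ ^ 2 := by
    have e1 := integral_norm_sq_eq (SchwartzMap.compSubConstCLM ℂ s φ)
    have e2 := integral_norm_sq_eq φ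
    rw [SchwartzMap.toLpCLM_apply, SchwartzMap.toLpCLM_apply, ← e1, ← e2]
    simp_rw [SchwartzMap.compSubConstCLM_apply]
    exact integral_sub_right_eq_self (fun x => ‖φ x‖ ^ 2) s
  exact (sq_eq_sq₀ (norm_nonneg _) (norm_nonneg _)).1 h

end Linearity

/-! ### Averaging over localised translates -/

/-- The Gaussian cut-off of `f` around the points where `c x = u`. -/
def cutoff (c : ℝ) (u : Eucl d) (f : 𝓢(Eucl d, ℂ)) : 𝓢(Eucl d, ℂ) :=
  SchwartzMap.smulLeftCLM ℂ
    ((gaussS (d := d) (1 / 2) (by norm_num)) ∘ (fun x => c • x - u)) f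

lemma cutoff_apply (c : ℝ) (u : Eucl d) (f : 𝓢(Eucl d, ℂ)) (x : Eucl d) :
    cutoff c u f x = (gauss (1 / 2) (c • x - u) : ℂ) * f x := by
  have h1 : Function.HasTemperateGrowth (fun x : Eucl d => c • x - u) :=
    ((c • ContinuousLinearMap.id ℝ (Eucl d)).hasTemperateGrowth).sub
      (Function.HasTemperateGrowth.const u)
  rw [cutoff, SchwartzMap.smulLeftCLM_apply_apply
    ((SchwartzMap.hasTemperateGrowth _).comp h1), Function.comp, gaussS_apply, Complex.real_smul]

/-- The total mass of `gauss 1`. -/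
def gaussMass (d : ℕ) : ℝ := ∫ v : Eucl d, gauss 1 v

lemma gaussMass_pos (d : ℕ) : 0 < gaussMass d := by
  rw [gaussMass, integral_gauss one_pos]; positivity

/-- The squared cut-offs form a continuous partition of unity: for each `x` the integral of `gauss 1
(c • x - u)` over `u` is `gaussMass d`. -/
lemma integral_norm_sq_cutoff (c : ℝ) (f : 𝓢(Eucl d, ℂ)) :
    Integrable (fun u => ‖toL2 d (cutoff c u f)‖ ^ 2) ∧
    ∫ u, ‖toL2 d (cutoff c u f)‖ ^ 2 = gaussMass d * ‖toL2 d f‖ ^ 2 := by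
  have e : ∀ u, ‖toL2 d (cutoff c u f)‖ ^ 2 = ∫ x, ‖f x‖ ^ 2 * gauss 1 (c • x - u) := by
    intro u
    rw [SchwartzMap.toLpCLM_apply, ← integral_norm_sq_eq]
    congr 1; ext x
    rw [cutoff_apply, norm_mul, mul_pow, Complex.norm_real,
      Real.norm_of_nonneg (gauss_pos _ _).le, gauss_sq, mul_comm]
    norm_num
  have hf : Integrable (fun x => ‖f x‖ ^ 2) := by
    have := (f.memLp 2 volume).integrable_norm_pow (p := 2) (by norm_num)
    exact_mod_cast this
  have hI := integrable_shear (θ := fun x : Eucl d => c • x) (by fun_prop)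
    (hf.mul_prod (integrable_gauss (d := d) one_pos))
  simp_rw [e]
  refine ⟨hI.integral_prod_right, ?_⟩
  have hI' : Integrable (Function.uncurry fun (u x : Eucl d) =>
      ‖f x‖ ^ 2 * gauss 1 (c • x - u)) (volume.prod volume) := hI.swap
  rw [integral_integral_swap hI']
  simp_rw [integral_const_mul]
  have h2 : ∀ x : Eucl d, ∫ u : Eucl d, gauss 1 (c • x - u) = gaussMass d := fun x =>
    integral_sub_left_eq_self (fun u : Eucl d => gauss 1 u) volume (c • x)
  simp_rw [h2]
  rw [integral_mul_const, SchwartzMap.toLpCLM_apply, ← integral_norm_sq_eq, mul_comm]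

/-- The Wigner function of a Gaussian cut-off is a cut-off frequency average. -/
lemma gaussMass_mul_wigner_cutoff (c : ℝ) (u : Eucl d) (f : 𝓢(Eucl d, ℂ)) (p : Eucl d × Eucl d) :
    gaussMass d * wigner (cutoff c u f) (cutoff c u f) p = (gauss 1 (c • p.1 - u) : ℂ) *
      ∫ η : Eucl d, (gauss 1 η : ℂ) * wigner f f (p + (0, (c / (2 * Real.pi)) • η)) := by
  set h : Eucl d → ℂ := fun y => osc (4 * Real.pi * inner ℝ (p.1 - y) p.2) *
      (starRingEnd ℂ) (f ((2 : ℝ) • p.1 - y)) * f y with hh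
  have hI : Integrable h := integrable_wigner_integrand f.continuous (f.norm_le_seminorm ℝ)
    (f.integrable (μ := volume)) p
  have e1 : ∀ η : Eucl d, (gauss 1 η : ℂ) * wigner f f (p + (0, (c / (2 * Real.pi)) • η)) =
      2 ^ d * ∫ y, (gauss 1 η : ℂ) * h y * osc (inner ℝ ((2 * c) • (p.1 - y)) η) := by
    intro η
    rw [wigner, mul_left_comm]
    congr 1
    rw [← integral_const_mul]
    congr 1; ext y
    have e2 : 4 * Real.pi * inner ℝ ((p + (0, (c / (2 * Real.pi)) • η)).1 - y)
        (p + (0, (c / (2 * Real.pi)) • η)).2 = 4 * Real.pi * inner ℝ (p.1 - y) p.2 +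
        inner ℝ ((2 * c) • (p.1 - y)) η := by
      rw [Prod.fst_add, Prod.snd_add, add_zero, inner_add_right, inner_smul_right, inner_smul_left,
        RCLike.conj_to_real]
      have := Real.pi_pos.ne'
      field_simp
      ring
    rw [e2, osc_add, Prod.fst_add, add_zero]
    simp only [hh]
    ring
  have hIp : Integrable (fun q : Eucl d × Eucl d =>
      (gauss 1 q.1 : ℂ) * h q.2 * osc (inner ℝ ((2 * c) • (p.1 - q.2)) q.1)) := by
    have hb := ((integrable_gauss (d := d) one_pos).ofReal (𝕜 := ℂ)).mul_prod hI
    exact hb.mul_bdd (c := 1) (Continuous.aestronglyMeasurable (by fun_prop))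
      (Filter.Eventually.of_forall fun q => (norm_osc _).le)
  simp_rw [e1]
  rw [integral_const_mul, integral_integral_swap hIp, wigner, mul_left_comm, mul_left_comm _ (2 ^ d)]
  congr 1
  rw [← integral_const_mul, ← integral_const_mul]
  congr 1; ext y
  have e3 : ∫ η : Eucl d, (gauss 1 η : ℂ) * h y * osc (inner ℝ ((2 * c) • (p.1 - y)) η) =
      h y * ((gaussMass d : ℂ) * (gauss 1 (c • (p.1 - y)) : ℂ)) := by
    have := integral_osc_mul_gauss (d := d) one_pos ((2 * c) • (p.1 - y))
    rw [← integral_gauss one_pos] at this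
    have e4 : gauss (1 / (4 * 1)) ((2 * c) • (p.1 - y)) = gauss 1 (c • (p.1 - y)) := by
      simp only [gauss, norm_smul, Real.norm_eq_abs, abs_mul, abs_two, mul_pow, sq_abs]
      congr 1; ring
    rw [e4] at this
    rw [gaussMass, ← this, ← integral_const_mul]
    congr 1; ext η; ring
  -- By the parallelogram law, the cut-offs at `2m - y` and `y` combine into one at the midpoint `m`
  -- and a Gaussian in `c(m - y)`. By `e3` the latter is the Fourier transform of the Gaussian
  -- average over `η`.
  have e5 : gauss (1 / 2) (c • ((2 : ℝ) • p.1 - y) - u) * gauss (1 / 2) (c • y - u) =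
      gauss 1 (c • p.1 - u) * gauss 1 (c • (p.1 - y)) := by
    simp only [gauss, ← Real.exp_add]
    congr 1
    have := parallelogram_law_with_norm ℝ (c • p.1 - u) (c • (p.1 - y))
    rw [show c • p.1 - u + c • (p.1 - y) = c • ((2 : ℝ) • p.1 - y) - u by module,
      show c • p.1 - u - c • (p.1 - y) = c • y - u by module] at this
    linear_combination (-1 / 2) * this
  rw [e3, cutoff_apply, cutoff_apply, map_mul, Complex.conj_ofReal]
  simp only [hh]
  have e6 := congrArg (fun r : ℝ => (r : ℂ)) e5
  push_cast at e6
  linear_combination (gaussMass d * (osc (4 * Real.pi * inner ℝ (p.1 - y) p.2) *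
      (starRingEnd ℂ) (f ((2 : ℝ) • p.1 - y)) * f y)) * e6

/-- The fixed-`y` slices of a symbol in `(x, y, ξ)`. -/
def slice (b : Eucl d × Eucl d × Eucl d → ℝ) (y : Eucl d) (p : Eucl d × Eucl d) : ℝ :=
  b (p.1, y, p.2)

/-- The symbol `b(x, δx - εv, ξ + cη)`. -/
def jitter (b : Eucl d × Eucl d × Eucl d → ℝ) (δ ε c : ℝ) (s : Eucl d × Eucl d)
    (p : Eucl d × Eucl d) : ℝ :=
  b (p.1, δ • p.1 - ε • s.1, p.2 + c • s.2)

section Averaging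
variable {b : Eucl d × Eucl d × Eucl d → ℝ} {B : ℝ}

/-- Moves the frequency average from the Wigner function onto the symbol by translating `p`. A shift
by `cη/(2π)` in `κ` is a shift by `cη` in `ξ = 2πκ`. -/
lemma gaussMass_mul_weylForm_slice (hb : Continuous b) (hB : ∀ p, |b p| ≤ B) (c : ℝ)
    (y u : Eucl d) (f : 𝓢(Eucl d, ℂ)) :
    gaussMass d * weylForm (slice b y) (cutoff c u f) (cutoff c u f) =
      ∫ η : Eucl d, ∫ p : Eucl d × Eucl d, (b (p.1, y, (2 * Real.pi) • p.2 - c • η) : ℂ) *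
        ((gauss 1 (c • p.1 - u) * gauss 1 η : ℝ) * wigner f f p) := by
  have hs : Continuous (slice b y) := by unfold slice; fun_prop
  rw [weylForm_eq_integral_wigner hs (fun p => hB _), ← integral_const_mul]
  have e1 : ∀ p : Eucl d × Eucl d, gaussMass d * ((slice b y (p.1, (2 * Real.pi) • p.2) : ℂ) *
      wigner (cutoff c u f) (cutoff c u f) p) = ∫ η : Eucl d,
      ((slice b y (p.1, (2 * Real.pi) • p.2) * gauss 1 (c • p.1 - u) : ℝ) : ℂ) *
        ((gauss 1 η : ℂ) * wigner f f (p + (0, (c / (2 * Real.pi)) • η))) := by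
    intro p
    rw [mul_left_comm, gaussMass_mul_wigner_cutoff, integral_const_mul]
    push_cast; ring
  simp_rw [e1]
  have hI0 : Integrable (fun q : Eucl d × (Eucl d × Eucl d) =>
      (gauss 1 q.1 : ℂ) * wigner f f (-q.2)) :=
    ((integrable_gauss (d := d) one_pos).ofReal (𝕜 := ℂ)).mul_prod (integrable_wigner f f).comp_neg
  have hI1 := integrable_shear (θ := fun η : Eucl d =>
    -((0, (c / (2 * Real.pi)) • η) : Eucl d × Eucl d)) (by fun_prop) hI0
  simp only [neg_sub, sub_neg_eq_add] at hI1
  have hI2 : Integrable (fun q : Eucl d × (Eucl d × Eucl d) =>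
      ((slice b y (q.2.1, (2 * Real.pi) • q.2.2) * gauss 1 (c • q.2.1 - u) : ℝ) : ℂ) *
        ((gauss 1 q.1 : ℂ) * wigner f f (q.2 + (0, (c / (2 * Real.pi)) • q.1)))) := by
    refine hI1.bdd_mul (c := B) (Continuous.aestronglyMeasurable (by fun_prop))
      (Filter.Eventually.of_forall fun q => ?_)
    rw [Complex.norm_real, norm_mul, Real.norm_of_nonneg (gauss_pos _ _).le]
    exact (mul_le_of_le_one_right (norm_nonneg _) (gauss_le_one one_pos.le _)).trans (hB _)
  have hI3 : Integrable (Function.uncurry fun (p : Eucl d × Eucl d) (η : Eucl d) =>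
      ((slice b y (p.1, (2 * Real.pi) • p.2) * gauss 1 (c • p.1 - u) : ℝ) : ℂ) *
        ((gauss 1 η : ℂ) * wigner f f (p + (0, (c / (2 * Real.pi)) • η))))
      (volume.prod volume) := hI2.swap
  rw [integral_integral_swap hI3]
  congr 1; ext η
  rw [← integral_sub_right_eq_self _ ((0, (c / (2 * Real.pi)) • η) : Eucl d × Eucl d)]
  congr 1; ext p
  have e2 : (2 * Real.pi) • (p - (0, (c / (2 * Real.pi)) • η)).2 =
      (2 * Real.pi) • p.2 - c • η := by
    rw [Prod.snd_sub, smul_sub, smul_smul, mul_div_cancel₀ _ (by positivity)]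
  rw [e2, sub_add_cancel, Prod.fst_sub, sub_zero, slice]
  push_cast; ring

/-- The averaging identity: Gaussian averages of jittered symbols are superpositions of the slices
acting on localised functions. -/
lemma integral_weylForm_jitter (hb : Continuous b) (hB : ∀ p, |b p| ≤ B) (ε c : ℝ)
    (f : 𝓢(Eucl d, ℂ)) :
    Integrable (fun s => (phaseGauss 1 one_pos s : ℂ) * weylForm (jitter b (ε * c) ε c s) f f) ∧
    Integrable (fun u => gaussMass d * weylForm (slice b (ε • u)) (cutoff c u f) (cutoff c u f)) ∧
    ∫ s, (phaseGauss 1 one_pos s : ℂ) * weylForm (jitter b (ε * c) ε c s) f f =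
      ∫ u, gaussMass d * weylForm (slice b (ε • u)) (cutoff c u f) (cutoff c u f) := by
  set G : Eucl d × Eucl d → ℝ := ⇑(phaseGauss (d := d) 1 one_pos) with hG
  have hGc : Continuous G := (phaseGauss (d := d) 1 one_pos).continuous
  have hGI : Integrable G := (phaseGauss (d := d) 1 one_pos).integrable
  set F : (Eucl d × Eucl d) × (Eucl d × Eucl d) → ℂ := fun q =>
    (jitter b (ε * c) ε c q.2 (q.1.1, (2 * Real.pi) • q.1.2) : ℂ) *
      (wigner f f q.1 * (G q.2 : ℂ)) with hF
  have hFI : Integrable F := by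
    refine ((integrable_wigner f f).mul_prod (hGI.ofReal (𝕜 := ℂ))).bdd_mul (c := B)
      (Continuous.aestronglyMeasurable (by unfold jitter; fun_prop))
      (Filter.Eventually.of_forall fun q => ?_)
    rw [Complex.norm_real]; exact hB _
  -- The change of variables behind the identity is `s = (cx - u, -η)`: with `δ = εc` it gives `δx -
  -- ε s.1 = εu`, which no longer depends on `x`, so at fixed `u` the jittered symbol is a slice.
  have hJI := integrable_shear (θ := fun p : Eucl d × Eucl d => ((c • p.1, 0) : Eucl d × Eucl d))
    (by fun_prop) hFI
  have hjit : ∀ s, (G s : ℂ) * weylForm (jitter b (ε * c) ε c s) f f = ∫ p, F (p, s) := by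
    intro s
    have hj : Continuous (jitter b (ε * c) ε c s) := by unfold jitter; fun_prop
    rw [weylForm_eq_integral_wigner hj (fun p => hB _), ← integral_const_mul]
    congr 1; ext p
    simp only [hF]; ring
  have hslice : ∀ u, gaussMass d * weylForm (slice b (ε • u)) (cutoff c u f) (cutoff c u f) =
      ∫ η, ∫ p : Eucl d × Eucl d, F (p, (c • p.1, 0) - (u, η)) := by
    intro u
    rw [gaussMass_mul_weylForm_slice hb hB]
    congr 1; ext η
    congr 1; ext p
    simp only [hF, hG, jitter, phaseGauss_apply, Prod.mk_sub_mk, zero_sub, gauss_neg]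
    have e1 : (ε * c) • p.1 - ε • (c • p.1 - u) = ε • u := by module
    rw [e1, smul_neg, ← sub_eq_add_neg]
    ring
  have hI3 := hJI.integral_prod_right
  simp_rw [hjit, hslice]
  refine ⟨hFI.integral_prod_right, hI3.integral_prod_left, ?_⟩
  have hFS : Integrable (Function.uncurry fun (s p : Eucl d × Eucl d) => F (p, s))
      (volume.prod volume) := hFI.swap
  have hJS : Integrable (Function.uncurry fun (s p : Eucl d × Eucl d) =>
      F (p, (c • p.1, 0) - s)) (volume.prod volume) := hJI.swap
  rw [integral_integral_swap hFS]
  have h4 : ∫ u, ∫ η, ∫ p : Eucl d × Eucl d, F (p, (c • p.1, 0) - (u, η)) =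
      ∫ s, ∫ p : Eucl d × Eucl d, F (p, (c • p.1, 0) - s) :=
    (integral_prod _ hI3).symm
  rw [h4, integral_integral_swap hJS]
  congr 1; ext p
  exact (integral_sub_left_eq_self (fun s => F (p, s)) volume _).symm

/-- Jittering displaces the argument of `b` by `±(0, -ε s.1, c s.2)`, of norm at most `√|δ| ‖s‖`, so
the second difference gains `|δ| ‖s‖²`. Restricting to `y = δx` costs nothing since `|δ| ≤ 1`. -/
lemma derivBound_jitter_second_difference (hb : DerivBound (cvOrder d + 2) B b) {δ ε c : ℝ}
    (hδ : |δ| ≤ 1) (hε : ε ^ 2 ≤ |δ|) (hc : c ^ 2 ≤ |δ|) (s : Eucl d × Eucl d) :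
    DerivBound (cvOrder d) (B * (|δ| * ‖s‖ ^ 2)) (fun p => jitter b δ ε c s p +
      jitter b δ ε c (-s) p - (2 : ℝ) • jitter b δ ε c 0 p) := by
  set k : Eucl d × Eucl d × Eucl d := (0, -(ε • s.1), c • s.2) with hk
  have h1 := hb.second_difference k
  have hkn : ‖k‖ ^ 2 ≤ |δ| * ‖s‖ ^ 2 := by
    have h2 : ‖k‖ ≤ Real.sqrt |δ| * ‖s‖ := by
      rw [hk, Prod.norm_mk, Prod.norm_mk, norm_zero, norm_neg, norm_smul, norm_smul,
        Real.norm_eq_abs, Real.norm_eq_abs]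
      refine max_le (by positivity) (max_le ?_ ?_)
      · gcongr
        · exact Real.abs_le_sqrt hε
        · exact norm_fst_le s
      · gcongr
        · exact Real.abs_le_sqrt hc
        · exact norm_snd_le s
    calc ‖k‖ ^ 2 ≤ (Real.sqrt |δ| * ‖s‖) ^ 2 := by gcongr
      _ = _ := by rw [mul_pow, Real.sq_sqrt (abs_nonneg δ)]
  have h3 : DerivBound (cvOrder d) (B * (|δ| * ‖s‖ ^ 2)) _ :=
    h1.mono le_rfl (mul_le_mul_of_nonneg_left hkn hb.nonneg)
  have h4 := h3.comp_linear ((ContinuousLinearMap.fst ℝ (Eucl d) (Eucl d)).prod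
    ((δ • ContinuousLinearMap.fst ℝ (Eucl d) (Eucl d)).prod
      (ContinuousLinearMap.snd ℝ (Eucl d) (Eucl d)))) le_rfl (by
    refine ContinuousLinearMap.opNorm_le_bound _ zero_le_one fun p => ?_
    change ‖(p.1, δ • p.1, p.2)‖ ≤ _
    rw [one_mul, Prod.norm_mk, Prod.norm_mk, norm_smul, Real.norm_eq_abs]
    refine max_le (norm_fst_le p) (max_le ?_ (norm_snd_le p))
    exact (mul_le_of_le_one_left (norm_nonneg _) hδ).trans (norm_fst_le p))
  rw [one_pow, mul_one] at h4
  convert h4 using 2 with p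
  change b (p.1, δ • p.1 - ε • s.1, p.2 + c • s.2) +
    b (p.1, δ • p.1 - ε • (-s).1, p.2 + c • (-s).2) -
    (2 : ℝ) • b (p.1, δ • p.1 - ε • (0 : Eucl d × Eucl d).1, p.2 + c • (0 : Eucl d × Eucl d).2) =
    b ((p.1, δ • p.1, p.2) + k) + b ((p.1, δ • p.1, p.2) - k) - (2 : ℝ) • b (p.1, δ • p.1, p.2)
  rw [hk]
  simp [sub_eq_add_neg]

/-- The constant of `weylForm_diagonal_le`. -/
def averageConst (d : ℕ) : ℝ :=
  cvConst d * (∫ s : Eucl d × Eucl d, phaseGauss 1 one_pos s * ‖s‖ ^ 2) / (2 * gaussMass d ^ 2)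

lemma averageConst_nonneg (d : ℕ) : 0 ≤ averageConst d := by
  have h1 := cvConst_nonneg d
  have h2 := gaussMass_pos d
  have h3 : 0 ≤ ∫ s : Eucl d × Eucl d, phaseGauss 1 one_pos s * ‖s‖ ^ 2 := by
    refine integral_nonneg fun s => ?_
    have h4 := gauss_pos 1 s.1
    have h5 := gauss_pos 1 s.2
    rw [phaseGauss_apply]
    positivity
  unfold averageConst; positivity

/-- If all slices `b(·, y, ·)` have Weyl forms bounded above by `E`, then the Weyl form of the slowly
varying diagonal symbol `b(x, δx, ξ)` is bounded above by `E + O(δ)`. -/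
theorem weylForm_diagonal_le (hb : DerivBound (cvOrder d + 2) B b) {δ : ℝ} (hδ : |δ| ≤ 1) {E : ℝ}
    (hE : ∀ y h, (weylForm (slice b y) h h).re ≤ E * ‖toL2 d h‖ ^ 2) (f : 𝓢(Eucl d, ℂ)) :
    (weylForm (fun p => b (p.1, δ • p.1, p.2)) f f).re ≤
      (E + averageConst d * B * |δ|) * ‖toL2 d f‖ ^ 2 := by
  -- The errors from freezing `y` and from smearing `ξ` are of order `ε²` and `c²`; under `εc = δ`
  -- they balance at `√|δ|`. The sign of `δ` is put into `c`.
  obtain ⟨ε, c, hεc, hε, hc⟩ : ∃ ε c : ℝ, ε * c = δ ∧ ε ^ 2 = |δ| ∧ c ^ 2 = |δ| := by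
    rcases le_total 0 δ with h | h
    · exact ⟨√δ, √δ, Real.mul_self_sqrt h, by rw [Real.sq_sqrt h, abs_of_nonneg h],
        by rw [Real.sq_sqrt h, abs_of_nonneg h]⟩
    · have h' : 0 ≤ -δ := by linarith
      refine ⟨√(-δ), -√(-δ), ?_, by rw [Real.sq_sqrt h', abs_of_nonpos h],
        by rw [neg_sq, Real.sq_sqrt h', abs_of_nonpos h]⟩
      rw [mul_neg, Real.mul_self_sqrt h', neg_neg]
  have hbc := hb.smooth.continuous
  have hbB : ∀ p, |b p| ≤ B := hb.norm_le
  have hm := gaussMass_pos d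
  obtain ⟨hI1, hI2, hI3⟩ := integral_weylForm_jitter hbc hbB ε c f
  rw [hεc] at hI1 hI3
  set G : Eucl d × Eucl d → ℝ := ⇑(phaseGauss (d := d) 1 one_pos) with hG
  have hG0 : ∀ s, 0 ≤ G s := fun s => by
    rw [hG, phaseGauss_apply]; exact mul_nonneg (gauss_pos _ _).le (gauss_pos _ _).le
  have hGneg : ∀ s, G (-s) = G s := fun s => by
    rw [hG, phaseGauss_apply, phaseGauss_apply, Prod.fst_neg, Prod.snd_neg, gauss_neg, gauss_neg]
  have hGI : Integrable G := (phaseGauss (d := d) 1 one_pos).integrable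
  have hGmass : ∫ s, G s = gaussMass d ^ 2 := by
    simp_rw [hG, phaseGauss_apply]
    rw [Measure.volume_eq_prod, integral_prod_mul (gauss 1) (gauss 1), sq]
    rfl
  have hG2 : Integrable (fun s => G s * ‖s‖ ^ 2) := by
    have := (phaseGauss (d := d) 1 one_pos).integrable_pow_mul volume 2
    refine this.congr (Filter.Eventually.of_forall fun s => ?_)
    simp only
    rw [Real.norm_of_nonneg (hG0 s), mul_comm]
  set Φ : Eucl d × Eucl d → ℝ := fun s => (weylForm (jitter b δ ε c s) f f).re with hΦ
  have hΦI : Integrable (fun s => G s * Φ s) := by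
    refine hI1.re.congr (Filter.Eventually.of_forall fun s => ?_)
    simp only [hΦ, RCLike.re_eq_complex_re, Complex.re_ofReal_mul]
  have hΦneg : Integrable (fun s => G s * Φ (-s)) := by
    refine hΦI.comp_neg.congr (Filter.Eventually.of_forall fun s => ?_)
    simp only [hGneg]
  have hΦint : ∫ s, G s * Φ (-s) = ∫ s, G s * Φ s := by
    rw [← integral_neg_eq_self (fun s => G s * Φ s)]
    simp only [hGneg]
  -- The averaging identity, the slice bound on each cut-off piece, and the partition of unity for
  -- the squared norms.
  have hup : ∫ s, G s * Φ s ≤ E * gaussMass d ^ 2 * ‖toL2 d f‖ ^ 2 := by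
    have e1 : ∫ s, G s * Φ s = ∫ u, gaussMass d *
        (weylForm (slice b (ε • u)) (cutoff c u f) (cutoff c u f)).re := by
      have := congrArg Complex.re hI3
      have r1 := integral_re hI1
      have r2 := integral_re hI2
      simp only [RCLike.re_eq_complex_re, Complex.re_ofReal_mul] at r1 r2
      rw [hΦ, r1, r2, this]
    have hI2' : Integrable (fun u => gaussMass d *
        (weylForm (slice b (ε • u)) (cutoff c u f) (cutoff c u f)).re) := by
      refine hI2.re.congr (Filter.Eventually.of_forall fun s => ?_)
      simp only [RCLike.re_eq_complex_re, Complex.re_ofReal_mul]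
    obtain ⟨hc1, hc2⟩ := integral_norm_sq_cutoff c f
    rw [e1]
    calc _ ≤ ∫ u, gaussMass d * (E * ‖toL2 d (cutoff c u f)‖ ^ 2) :=
          integral_mono hI2' ((hc1.const_mul E).const_mul _) fun u =>
            mul_le_mul_of_nonneg_left (hE _ _) hm.le
      _ = _ := by rw [integral_const_mul, integral_const_mul, hc2]; ring
  -- The second difference of the symbol, controlled in operator norm by Calderón–Vaillancourt.
  have hdiff : ∀ s, 2 * Φ 0 ≤ Φ s + Φ (-s) +
      cvConst d * B * |δ| * ‖toL2 d f‖ ^ 2 * ‖s‖ ^ 2 := by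
    intro s
    have h1 := norm_weylForm_le (derivBound_jitter_second_difference hb hδ hε.le hc.le s) f f
    have hj : ∀ s, Continuous (jitter b δ ε c s) := fun s => by unfold jitter; fun_prop
    rw [weylForm_second_difference (hj _) (fun p => hbB _) (hj _) (fun p => hbB _) (hj _)
      (fun p => hbB _)] at h1
    have h2 := (abs_le.1 ((Complex.abs_re_le_norm _).trans h1)).1
    simp only [Complex.sub_re, Complex.add_re, Complex.mul_re, Complex.re_ofNat, Complex.im_ofNat,
      zero_mul, sub_zero] at h2
    simp only [hΦ]
    have e : cvConst d * (B * (|δ| * ‖s‖ ^ 2)) * (‖f.toLp 2 (volume : Measure (Eucl d))‖ *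
        ‖f.toLp 2 (volume : Measure (Eucl d))‖) =
        cvConst d * B * |δ| * ‖toL2 d f‖ ^ 2 * ‖s‖ ^ 2 := by
      rw [SchwartzMap.toLpCLM_apply]; ring
    rw [e] at h2
    linarith
  have hsum : Integrable (fun s => G s * Φ s + G s * Φ (-s)) := hΦI.add hΦneg
  -- Integrating against the even weight `G`, `Φ s` and `Φ (-s)` have the same average, already
  -- bounded by `hup`.
  have hmono : ∫ s, G s * (2 * Φ 0) ≤ ∫ s, (G s * Φ s + G s * Φ (-s)) +
      cvConst d * B * |δ| * ‖toL2 d f‖ ^ 2 * (G s * ‖s‖ ^ 2) := by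
    refine integral_mono (hGI.mul_const _) (hsum.add (hG2.const_mul _)) fun s => ?_
    have := mul_le_mul_of_nonneg_left (hdiff s) (hG0 s)
    simp only
    linarith
  rw [integral_mul_const, hGmass, integral_add hsum (hG2.const_mul _),
    integral_add hΦI hΦneg, hΦint, integral_const_mul] at hmono
  have hΦ0 : Φ 0 = (weylForm (fun p => b (p.1, δ • p.1, p.2)) f f).re := by
    simp only [hΦ]
    congr 2
    ext p
    simp [jitter]
  rw [← hΦ0, averageConst]
  have hm2 : 0 < 2 * gaussMass d ^ 2 := by positivity
  rw [← mul_le_mul_iff_right₀ hm2]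
  have e : 2 * gaussMass d ^ 2 * ((E + cvConst d * (∫ s : Eucl d × Eucl d,
      phaseGauss 1 one_pos s * ‖s‖ ^ 2) / (2 * gaussMass d ^ 2) * B * |δ|) * ‖toL2 d f‖ ^ 2) =
      2 * (E * gaussMass d ^ 2 * ‖toL2 d f‖ ^ 2) +
      cvConst d * B * |δ| * ‖toL2 d f‖ ^ 2 * ∫ s, G s * ‖s‖ ^ 2 := by
    field_simp
    ring
  rw [e]
  linarith

end Averaging

end

section

/-! ### Maps with bounded derivatives of positive order -/

/-- `f` is smooth and its derivatives of order between `1` and `N` are bounded by `M`. -/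
structure PosDerivBound {V F : Type*} [NormedAddCommGroup V] [NormedSpace ℝ V]
    [NormedAddCommGroup F] [NormedSpace ℝ F] (N : ℕ) (M : ℝ) (f : V → F) : Prop where
  smooth : ContDiff ℝ ∞ f
  bounded : ∀ n, 1 ≤ n → n ≤ N → ∀ x, ‖iteratedFDeriv ℝ n f x‖ ≤ M

section PosDerivBound
variable {V W F G : Type*} [NormedAddCommGroup V] [NormedSpace ℝ V] [NormedAddCommGroup W]
  [NormedSpace ℝ W] [NormedAddCommGroup F] [NormedSpace ℝ F] [NormedAddCommGroup G]
  [NormedSpace ℝ G] {N : ℕ} {M M' B : ℝ} {f g : V → F}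

lemma PosDerivBound.mono (h : PosDerivBound N M f) {N' : ℕ} (hN : N' ≤ N) (hM : M ≤ M') :
    PosDerivBound N' M' f :=
  ⟨h.smooth, fun n h1 hn x => (h.bounded n h1 (hn.trans hN) x).trans hM⟩

lemma PosDerivBound.add (hf : PosDerivBound N M f) (hg : PosDerivBound N M' g) :
    PosDerivBound N (M + M') (fun x => f x + g x) :=
  ⟨hf.smooth.add hg.smooth, fun n h1 hn x => by
    rw [fun_iteratedFDeriv_add_apply (hf.smooth.of_le (mod_cast le_top)).contDiffAt
      (hg.smooth.of_le (mod_cast le_top)).contDiffAt]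
    exact (norm_add_le _ _).trans (add_le_add (hf.bounded n h1 hn x) (hg.bounded n h1 hn x))⟩

lemma _root_.ContinuousLinearMap.posDerivBound (L : V →L[ℝ] F) (N : ℕ) :
    PosDerivBound N ‖L‖ (fun x => L x) := by
  refine ⟨L.contDiff, fun n h1 _ x => ?_⟩
  obtain rfl | h2 := h1.eq_or_lt
  · rw [← zero_add 1, ← norm_iteratedFDeriv_fderiv, norm_iteratedFDeriv_zero]
    exact (congrArg norm L.fderiv).le
  · obtain ⟨k, rfl⟩ : ∃ k, n = k + 2 := ⟨n - 2, by omega⟩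
    rw [← norm_iteratedFDeriv_fderiv]
    have : fderiv ℝ (fun x => L x) = fun _ => L := by ext1; exact L.fderiv
    rw [this, iteratedFDeriv_const_of_ne (by omega)]
    simp

lemma PosDerivBound.comp_linear (h : PosDerivBound N M f) (hM : 0 ≤ M) (L : W →L[ℝ] V)
    (hL : ‖L‖ ≤ 1) : PosDerivBound N M (fun x => f (L x)) := by
  refine ⟨h.smooth.comp L.contDiff, fun n h1 hn x => ?_⟩
  have e : iteratedFDeriv ℝ n (fun x => f (L x)) x = _ :=
    L.iteratedFDeriv_comp_right h.smooth x (i := n) (mod_cast le_top)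
  rw [e]
  refine (ContinuousMultilinearMap.norm_compContinuousLinearMap_le _ _).trans ?_
  rw [Finset.prod_const, Finset.card_univ, Fintype.card_fin]
  calc _ ≤ M * 1 ^ n := by gcongr; exact h.bounded n h1 hn _
    _ = M := by simp

lemma PosDerivBound.linear_comp (h : PosDerivBound N M f) (L : F →L[ℝ] G) {K : ℝ}
    (hL : ‖L‖ ≤ K) : PosDerivBound N (K * M) (fun x => L (f x)) := by
  refine ⟨L.contDiff.comp h.smooth, fun n h1 hn x => ?_⟩
  have hK := (norm_nonneg _).trans hL
  refine (L.norm_iteratedFDeriv_comp_left h.smooth.contDiffAt (mod_cast le_top)).trans ?_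
  gcongr
  exact h.bounded n h1 hn x

lemma PosDerivBound.fderiv (h : PosDerivBound (N + 1) M f) : DerivBound N M (fderiv ℝ f) :=
  ⟨h.smooth.fderiv_right (mod_cast le_top), fun n hn x => by
    rw [norm_iteratedFDeriv_fderiv]; exact h.bounded _ (by omega) (by omega) x⟩

/-- Faà di Bruno uses only derivatives of `f` of positive order, so `f` itself may be unbounded.
With `max 1 M`, the single bound `M` serves as the required `i`-th power for every `i ≥ 1`. -/
lemma DerivBound.comp {g : F → G} (hg : DerivBound N B g) (hf : PosDerivBound N M f) :
    DerivBound N (N.factorial * B * (max 1 M) ^ N) (fun x => g (f x)) := by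
  refine ⟨hg.smooth.comp hf.smooth, fun n hn x => ?_⟩
  have hB := hg.nonneg
  have h1 : 1 ≤ max 1 M := le_max_left _ _
  refine (norm_iteratedFDeriv_comp_le (C := B) (D := max 1 M) hg.smooth hf.smooth (mod_cast le_top)
    x (fun i hi => hg.bounded i (hi.trans hn) _) fun i hi hin => ?_).trans ?_
  · exact (hf.bounded i hi (hin.trans hn) x).trans
      ((le_max_right _ _).trans (le_self_pow₀ h1 (by omega)))
  · gcongr

end PosDerivBound

/-! ### The inverse shift -/

section InverseShift
variable {V : Type*} [NormedAddCommGroup V] [NormedSpace ℝ V] {F : V → V} {δ L : ℝ}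

/-- The map `x + δF(x)` perturbs the identity by a `1/2`-Lipschitz map, hence is a homeomorphism
`Φ`; a Neumann series inverts its derivative, so `Φ⁻¹` is smooth. Taking `s = -F ∘ Φ⁻¹` gives `y + δ
s(y) = Φ⁻¹(y)` without dividing by `δ`. -/
lemma exists_inverse_shift [CompleteSpace V] (hF : ContDiff ℝ ∞ F)
    (hL : ∀ x, ‖fderiv ℝ F x‖ ≤ L) (hδ : |δ| * L ≤ 1 / 2) :
    ∃ s : V → V, ContDiff ℝ ∞ s ∧ ∀ y, s y + F (y + δ • s y) = 0 := by
  have hsmall : ∀ x, ‖δ • fderiv ℝ F x‖ ≤ 1 / 2 := fun x => by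
    rw [norm_smul, Real.norm_eq_abs]
    exact (mul_le_mul_of_nonneg_left (hL x) (abs_nonneg _)).trans hδ
  have hdiff : Differentiable ℝ F := hF.differentiable (by simp)
  have hderiv : ∀ x, HasFDerivAt (fun x => δ • F x) (δ • fderiv ℝ F x) x := fun x =>
    (hdiff x).hasFDerivAt.const_smul δ
  have happrox : ApproximatesLinearOn (fun x => x + δ • F x)
      ((ContinuousLinearEquiv.refl ℝ V : V ≃L[ℝ] V) : V →L[ℝ] V) Set.univ (1 / 2) := by
    intro x _ y _
    have := Convex.norm_image_sub_le_of_norm_hasFDerivWithin_le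
      (fun x _ => (hderiv x).hasFDerivWithinAt) (fun x _ => hsmall x) convex_univ
      (Set.mem_univ y) (Set.mem_univ x)
    simpa [add_sub_add_comm] using this
  have hc : Subsingleton V ∨ (1 / 2 : NNReal) <
      ‖((ContinuousLinearEquiv.refl ℝ V).symm : V →L[ℝ] V)‖₊⁻¹ := by
    rcases subsingleton_or_nontrivial V with h | h
    · exact Or.inl h
    · right
      have : ‖((ContinuousLinearEquiv.refl ℝ V).symm : V →L[ℝ] V)‖₊ = 1 := by
        ext; exact ContinuousLinearMap.norm_id
      rw [this, inv_one]
      exact NNReal.half_lt_self one_ne_zero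
  set Φ : V ≃ₜ V := happrox.toHomeomorph _ hc with hΦ
  have hΦx : ∀ x, Φ x = x + δ • F x := fun _ => rfl
  have hunit : ∀ x, ∃ e : V ≃L[ℝ] V, (e : V →L[ℝ] V) = 1 - -(δ • fderiv ℝ F x) := fun x =>
    ⟨ContinuousLinearEquiv.unitsEquiv ℝ V (Units.oneSub (-(δ • fderiv ℝ F x))
      (by rw [norm_neg]; linarith [hsmall x])), by ext; rfl⟩
  choose e he using hunit
  have hinv : ContDiff ℝ ∞ Φ.symm := by
    refine Φ.contDiff_symm (f₀' := e) (fun x => ?_) ?_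
    · rw [he, sub_neg_eq_add]
      exact (hasFDerivAt_id x).add (hderiv x)
    · exact contDiff_id.add (contDiff_const.smul hF)
  refine ⟨fun y => -F (Φ.symm y), (hF.comp hinv).neg, fun y => ?_⟩
  have h := hΦx (Φ.symm y)
  rw [Φ.apply_symm_apply] at h
  have : y + δ • -F (Φ.symm y) = Φ.symm y := by
    rw [smul_neg, ← sub_eq_add_neg, sub_eq_iff_eq_add]; exact h
  rw [this, neg_add_cancel]

/-- Differentiating the equation gives `Ds = -(H + δ H ∘ Ds)` with `H(y) = DF(y + δ s(y))`. After
`n` more derivatives, the top derivative of `s` appears on the right only with coefficient at most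
`|δ| L ≤ 1/2` and is absorbed; the other terms are bounded by induction, uniformly in `δ`. -/
lemma exists_posDerivBound_inverse_shift (hF : ContDiff ℝ ∞ F)
    (hFb : ∀ N, ∃ M, PosDerivBound N M F) (hL : ∀ x, ‖fderiv ℝ F x‖ ≤ L) (N : ℕ) :
    ∃ M, 0 ≤ M ∧ ∀ δ : ℝ, |δ| ≤ 1 → |δ| * L ≤ 1 / 2 → ∀ s : V → V, ContDiff ℝ ∞ s →
      (∀ y, s y + F (y + δ • s y) = 0) → PosDerivBound N M s := by
  induction N with
  | zero => exact ⟨0, le_rfl, fun _ _ _ s hs _ => ⟨hs, fun n h1 hn => by omega⟩⟩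
  | succ n ih =>
    obtain ⟨M, hM0, hM⟩ := ih
    obtain ⟨A, hA⟩ := hFb (n + 1)
    have hA' := hA.fderiv
    set Q : ℝ := n.factorial * A * (max 1 (1 + M)) ^ n with hQ
    have hQ0 : 0 ≤ Q := by have := hA'.nonneg; positivity
    -- The factor `2` comes from absorbing the top-order term; `2 ^ n` bounds the sum of the
    -- binomial coefficients of the lower ones.
    refine ⟨max M (2 * (Q + 2 ^ n * Q * M)), hM0.trans (le_max_left _ _),
      fun δ hδ hδL s hs hsF => ⟨hs, fun k hk1 hk x => ?_⟩⟩
    have hsn := hM δ hδ hδL s hs hsF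
    rcases Nat.lt_or_ge k (n + 1) with hlt | hge
    · exact (hsn.bounded k hk1 (by omega) x).trans (le_max_left _ _)
    obtain rfl : k = n + 1 := by omega
    refine le_trans ?_ (le_max_right _ _)
    have hΨ : PosDerivBound n (1 + M) (fun y => y + δ • s y) :=
      (((ContinuousLinearMap.id ℝ V).posDerivBound n).add
        (hsn.linear_comp (δ • ContinuousLinearMap.id ℝ V) (K := 1) (by
          rw [norm_smul, Real.norm_eq_abs]
          exact mul_le_one₀ hδ (norm_nonneg _) ContinuousLinearMap.norm_id_le))).mono le_rfl (by
            rw [one_mul]; gcongr; exact ContinuousLinearMap.norm_id_le)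
    set H : V → V →L[ℝ] V := fun y => fderiv ℝ F (y + δ • s y) with hH
    have hHb : DerivBound n Q H := hA'.comp hΨ
    have hds : ContDiff ℝ ∞ (fderiv ℝ s) := hs.fderiv_right (mod_cast le_top)
    have hsd : Differentiable ℝ s := hs.differentiable (by simp)
    have heq : fderiv ℝ s = fun y => -(H y + δ • (ContinuousLinearMap.compL ℝ V V V (H y)
        (fderiv ℝ s y))) := by
      ext1 y
      have h1 : HasFDerivAt (fun y => s y + F (y + δ • s y)) _ y :=
        (hsd y).hasFDerivAt.add (((hF.differentiable (by simp)) _).hasFDerivAt.comp y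
          ((hasFDerivAt_id y).add ((hsd y).hasFDerivAt.const_smul δ)))
      have h2 : HasFDerivAt (fun y => s y + F (y + δ • s y)) (0 : V →L[ℝ] V) y := by
        simp only [hsF]; exact hasFDerivAt_const _ _
      have h3 := h1.unique h2
      rw [eq_neg_iff_add_eq_zero, ← h3]
      ext v
      simp [hH]
    have hcomp : ContDiff ℝ ∞ (fun y => ContinuousLinearMap.compL ℝ V V V (H y) (fderiv ℝ s y)) :=
      hHb.smooth.clm_comp hds
    have hle : ((n : ℕ∞) : WithTop ℕ∞) ≤ ∞ := mod_cast le_top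
    have hsum := (ContinuousLinearMap.compL ℝ V V V).norm_iteratedFDeriv_le_of_bilinear_of_le_one
      hHb.smooth hds x (n := n) hle (ContinuousLinearMap.norm_compL_le ℝ V V V)
    -- Splits off the term `i = 0`, the only one containing the derivative of `s` of order `n + 1`.
    rw [Finset.sum_range_succ'] at hsum
    have hrest : ∑ i ∈ Finset.range n, (n.choose (i + 1) : ℝ) * ‖iteratedFDeriv ℝ (i + 1) H x‖ *
        ‖iteratedFDeriv ℝ (n - (i + 1)) (fderiv ℝ s) x‖ ≤ 2 ^ n * Q * M := by
      calc _ ≤ ∑ i ∈ Finset.range n, (n.choose (i + 1) : ℝ) * Q * M := by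
            refine Finset.sum_le_sum fun i hi => ?_
            have hi := Finset.mem_range.1 hi
            gcongr
            · exact hHb.bounded _ (by omega) x
            · rw [norm_iteratedFDeriv_fderiv]
              exact hsn.bounded _ (by omega) (by omega) x
        _ ≤ _ := by
            simp_rw [mul_assoc]
            rw [← Finset.sum_mul]
            gcongr
            have h := Nat.sum_range_choose n
            rw [Finset.sum_range_succ'] at h
            exact_mod_cast (Nat.le_add_right _ _).trans h.le
    set T := ‖iteratedFDeriv ℝ n (fderiv ℝ s) x‖ with hT
    have hzero : |δ| * ((n.choose 0 : ℝ) * ‖iteratedFDeriv ℝ 0 H x‖ *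
        ‖iteratedFDeriv ℝ (n - 0) (fderiv ℝ s) x‖) ≤ 1 / 2 * T := by
      rw [Nat.choose_zero_right, Nat.cast_one, one_mul, norm_iteratedFDeriv_zero, Nat.sub_zero,
        ← mul_assoc]
      gcongr
      exact (mul_le_mul_of_nonneg_left (hL _) (abs_nonneg _)).trans hδL
    have hT2 : T ≤ Q + |δ| * ‖iteratedFDeriv ℝ n (fun y =>
        ContinuousLinearMap.compL ℝ V V V (H y) (fderiv ℝ s y)) x‖ := by
      rw [hT]
      conv_lhs => rw [heq]
      have e1 : (fun y => -(H y + δ • (ContinuousLinearMap.compL ℝ V V V (H y)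
        (fderiv ℝ s y)))) = -(H + δ • fun y => ContinuousLinearMap.compL ℝ V V V (H y)
        (fderiv ℝ s y)) := rfl
      have hδc : ContDiff ℝ n (δ • fun y => ContinuousLinearMap.compL ℝ V V V (H y)
        (fderiv ℝ s y)) := (hcomp.of_le hle).const_smul δ
      rw [e1, iteratedFDeriv_neg_apply, norm_neg, iteratedFDeriv_add_apply
        (hHb.smooth.of_le hle).contDiffAt hδc.contDiffAt,
        iteratedFDeriv_const_smul_apply (hcomp.of_le hle).contDiffAt]
      refine (norm_add_le _ _).trans ?_
      rw [norm_smul, Real.norm_eq_abs]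
      gcongr
      exact hHb.bounded n le_rfl x
    rw [← norm_iteratedFDeriv_fderiv, ← hT]
    have h4 := mul_le_mul_of_nonneg_left hsum (abs_nonneg δ)
    rw [mul_add] at h4
    have h5 : |δ| * (2 ^ n * Q * M) ≤ 1 * (2 ^ n * Q * M) := by gcongr
    have h6 := mul_le_mul_of_nonneg_left hrest (abs_nonneg δ)
    linarith

end InverseShift

end

section

/-! ### Perturbed symbols -/

variable {d : ℕ}

lemma IsSymbol.exists_derivBound {a : Eucl d × Eucl d → ℝ} (ha : IsSymbol a) (N : ℕ) :
    ∃ B, DerivBound N B a := by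
  choose C hC using ha.bounded
  refine ⟨∑ n ∈ Finset.range (N + 1), |C n|, ha.smooth, fun n hn x => ?_⟩
  exact (hC n x).trans ((le_abs_self _).trans (Finset.single_le_sum (f := fun n => |C n|)
    (fun _ _ => abs_nonneg _) (Finset.mem_range.2 (by omega))))

lemma IsShift.exists_posDerivBound {F : Eucl d → Eucl d} (hF : IsShift F) (N : ℕ) :
    ∃ M, 0 ≤ M ∧ PosDerivBound N M F := by
  have : ∀ n, ∃ C : ℝ, 1 ≤ n → ∀ x, ‖iteratedFDeriv ℝ n F x‖ ≤ C := fun n => by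
    by_cases h : 1 ≤ n
    · obtain ⟨C, hC⟩ := hF.bounded n h
      exact ⟨C, fun _ => hC⟩
    · exact ⟨0, fun h' => absurd h' h⟩
  choose C hC using this
  refine ⟨∑ n ∈ Finset.range (N + 1), |C n|, Finset.sum_nonneg fun _ _ => abs_nonneg _, hF.smooth,
    fun n h1 hn x => ?_⟩
  exact (hC n h1 x).trans ((le_abs_self _).trans (Finset.single_le_sum (f := fun n => |C n|)
    (fun _ _ => abs_nonneg _) (Finset.mem_range.2 (by omega))))

/-- The symbol `(x, y, ξ) ↦ a(x + F(y), ξ)`, in which the two scales are decoupled. -/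
def twoScale (a : Eucl d × Eucl d → ℝ) (F : Eucl d → Eucl d) (p : Eucl d × Eucl d × Eucl d) : ℝ :=
  a (p.1 + F p.2.1, p.2.2)

/-- The bound on the derivatives of `twoScale a F` in terms of those for `a` and `F`. -/
def twoScaleBound (N : ℕ) (B M : ℝ) : ℝ := N.factorial * B * (max 1 (1 + M)) ^ N

lemma derivBound_twoScale {N : ℕ} {B M : ℝ} {a : Eucl d × Eucl d → ℝ} {F : Eucl d → Eucl d}
    (ha : DerivBound N B a) (hM : 0 ≤ M) (hF : PosDerivBound N M F) :
    DerivBound N (twoScaleBound N B M) (twoScale a F) := by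
  let P1 : (Eucl d × Eucl d × Eucl d) →L[ℝ] Eucl d := ContinuousLinearMap.fst ℝ _ _
  let P2 : (Eucl d × Eucl d × Eucl d) →L[ℝ] Eucl d × Eucl d := ContinuousLinearMap.snd ℝ _ _
  let L : (Eucl d × Eucl d × Eucl d) →L[ℝ] Eucl d × Eucl d :=
    P1.prod ((ContinuousLinearMap.snd ℝ _ _).comp P2)
  let Y : (Eucl d × Eucl d × Eucl d) →L[ℝ] Eucl d := (ContinuousLinearMap.fst ℝ _ _).comp P2
  have hL : ‖L‖ ≤ 1 := L.opNorm_le_bound zero_le_one fun p => by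
    rw [one_mul]
    exact max_le (norm_fst_le p) ((norm_snd_le p.2).trans (norm_snd_le p))
  have hY : ‖Y‖ ≤ 1 := Y.opNorm_le_bound zero_le_one fun p => by
    rw [one_mul]
    exact (norm_fst_le p.2).trans (norm_snd_le p)
  have hI : ‖ContinuousLinearMap.inl ℝ (Eucl d) (Eucl d)‖ ≤ 1 :=
    ContinuousLinearMap.opNorm_le_bound _ zero_le_one fun x => by simp
  have h := ((L.posDerivBound N).add (((hF.comp_linear hM Y hY).linear_comp _ hI))).mono
    (le_refl N) (M' := 1 + M) (by rw [one_mul]; gcongr)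
  have h2 := ha.comp h
  refine ⟨?_, ?_⟩
  · convert h2.smooth using 2 with p
    simp [twoScale, L, Y, P1, P2]
  · have e : twoScale a F = fun x =>
        a (L x + ContinuousLinearMap.inl ℝ (Eucl d) (Eucl d) (F (Y x))) := by
      ext p
      simp [twoScale, L, Y, P1, P2]
    rw [e]
    exact h2.bounded

lemma derivBound_perturbed {N : ℕ} {B M : ℝ} {a : Eucl d × Eucl d → ℝ} {F : Eucl d → Eucl d}
    (ha : DerivBound N B a) (hM : 0 ≤ M) (hF : PosDerivBound N M F) (δ : ℝ) :
    DerivBound N (twoScaleBound N B M * (max 1 |δ|) ^ N) (perturbed a F δ) := by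
  let L : (Eucl d × Eucl d) →L[ℝ] Eucl d × Eucl d × Eucl d :=
    (ContinuousLinearMap.fst ℝ _ _).prod
      ((δ • ContinuousLinearMap.fst ℝ _ _).prod (ContinuousLinearMap.snd ℝ _ _))
  refine (derivBound_twoScale ha hM hF).comp_linear L (le_max_left _ _) ?_
  refine L.opNorm_le_bound (by positivity) fun p => ?_
  have h1 := norm_fst_le p
  have h2 := norm_snd_le p
  have h3 : 1 ≤ max 1 |δ| := le_max_left _ _
  have h4 : |δ| ≤ max 1 |δ| := le_max_right _ _
  refine max_le ?_ (max_le ?_ ?_)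
  · exact h1.trans (le_mul_of_one_le_left (norm_nonneg _) h3)
  · change ‖δ • p.1‖ ≤ _
    rw [norm_smul, Real.norm_eq_abs]
    gcongr
  · exact h2.trans (le_mul_of_one_le_left (norm_nonneg _) h3)

/-- The quadratic form of the Weyl quantization of `a` is bounded above by `E`. -/
def FormLE (a : Eucl d × Eucl d → ℝ) (E : ℝ) : Prop :=
  ∀ φ : 𝓢(Eucl d, ℂ), (weylForm a φ φ).re ≤ E * ‖toL2 d φ‖ ^ 2

lemma FormLE.mono {a : Eucl d × Eucl d → ℝ} {E E' : ℝ} (h : FormLE a E) (hE : E ≤ E') :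
    FormLE a E' := fun φ => (h φ).trans (by gcongr)

lemma FormLE.translate {a : Eucl d × Eucl d → ℝ} {E : ℝ} (h : FormLE a E) (s : Eucl d) :
    FormLE (fun p => a (p.1 + s, p.2)) E := fun φ => by
  rw [weylForm_translate, ← norm_toL2_translate s φ]
  exact h _

/-- The slice of `twoScale a F` at `y` is `a` translated by `F y`, so it has the form bound of `a`.
-/
lemma formLE_perturbed {B M : ℝ} {a : Eucl d × Eucl d → ℝ} {F : Eucl d → Eucl d}
    (ha : DerivBound (cvOrder d + 2) B a) (hM : 0 ≤ M) (hF : PosDerivBound (cvOrder d + 2) M F)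
    {δ : ℝ} (hδ : |δ| ≤ 1) {E : ℝ} (h : FormLE a E) :
    FormLE (perturbed a F δ)
      (E + averageConst d * twoScaleBound (cvOrder d + 2) B M * |δ|) :=
  weylForm_diagonal_le (derivBound_twoScale ha hM hF) hδ fun y => h.translate (F y)

/-- At `y = δx` the two shifts add up to `s(y) + F(y + δ s(y))`, which vanishes. -/
lemma perturbed_perturbed {a : Eucl d × Eucl d → ℝ} {F s : Eucl d → Eucl d} {δ : ℝ}
    (hs : ∀ y, s y + F (y + δ • s y) = 0) : perturbed (perturbed a F δ) s δ = a := by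
  ext p
  simp only [perturbed]
  rw [smul_add, add_assoc, hs, add_zero]

lemma abs_re_weylForm_le {B : ℝ} {a : Eucl d × Eucl d → ℝ} (ha : DerivBound (cvOrder d) B a)
    (φ : 𝓢(Eucl d, ℂ)) : |(weylForm a φ φ).re| ≤ cvConst d * B * ‖toL2 d φ‖ ^ 2 := by
  refine (Complex.abs_re_le_norm _).trans ((norm_weylForm_le ha φ φ).trans (le_of_eq ?_))
  rw [SchwartzMap.toLpCLM_apply]; ring

lemma formLE_of_derivBound {B : ℝ} {a : Eucl d × Eucl d → ℝ} (ha : DerivBound (cvOrder d) B a) :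
    FormLE a (cvConst d * B) := fun φ => (abs_le.1 (abs_re_weylForm_le ha φ)).2

/-- Needed when `δ` is too large for the inverse shift: a form bound cannot lie below minus the norm
bound. -/
lemma FormLE.neg_le {B E : ℝ} {a : Eucl d × Eucl d → ℝ} (ha : DerivBound (cvOrder d) B a)
    (h : FormLE a E) : -(cvConst d * B) ≤ E := by
  obtain ⟨φ, hφ⟩ : ∃ φ, toL2 d φ ≠ 0 := by
    by_contra! h0
    have := nontrivial_L2 (d := d)
    obtain ⟨v, hv⟩ := exists_ne (0 : L2 d)
    refine hv (denseRange_toL2.induction_on (p := fun v => v = 0) v (isClosed_singleton) h0)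
  have h1 := (abs_le.1 (abs_re_weylForm_le ha φ)).1.trans (h φ)
  rw [← neg_mul] at h1
  exact le_of_mul_le_mul_right h1 (by positivity)

/-- Both directions of the comparison of form bounds, with constants independent of `δ`. -/
theorem exists_formLE_perturbed {a : Eucl d × Eucl d → ℝ} (ha : IsSymbol a)
    {F : Eucl d → Eucl d} (hF : IsShift F) :
    ∃ C : ℝ, 0 ≤ C ∧ ∀ δ : ℝ, |δ| ≤ 1 → ∀ E,
      (FormLE a E → FormLE (perturbed a F δ) (E + C * |δ|)) ∧
      (FormLE (perturbed a F δ) E → FormLE a (E + C * |δ|)) := by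
  set N := cvOrder d + 2 with hN
  obtain ⟨B, hB⟩ := ha.exists_derivBound N
  obtain ⟨M, hM0, hM⟩ := hF.exists_posDerivBound N
  have hFL : ∀ x, ‖fderiv ℝ F x‖ ≤ M := fun x =>
    ((hM.mono (N' := 0 + 1) (by omega) le_rfl).fderiv).norm_le x
  obtain ⟨S, hS0, hS⟩ := exists_posDerivBound_inverse_shift hF.smooth
    (fun N => (hF.exists_posDerivBound N).imp fun _ h => h.2) hFL N
  set B' := twoScaleBound N B M with hB'
  have hpert : ∀ δ : ℝ, |δ| ≤ 1 → DerivBound N B' (perturbed a F δ) := fun δ hδ => by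
    simpa [max_eq_left hδ] using derivBound_perturbed hB hM0 hM δ
  have hB0 := hB.nonneg
  have hB'0 : 0 ≤ B' := (hpert 0 (by simp)).nonneg
  have hcv := cvConst_nonneg d
  have hav := averageConst_nonneg d
  have hB''0 : 0 ≤ twoScaleBound N B' S := by unfold twoScaleBound; positivity
  set C1 := averageConst d * B'
  set C2 := averageConst d * twoScaleBound N B' S
  set C3 := cvConst d * (B + B') * (2 * (M + 1))
  have h1 : 0 ≤ C1 := by positivity
  have h2 : 0 ≤ C2 := by positivity
  have h3 : 0 ≤ C3 := by positivity
  refine ⟨C1 + C2 + C3, by positivity, fun δ hδ E => ⟨fun h => ?_, fun h => ?_⟩⟩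
  · exact (formLE_perturbed hB hM0 hM hδ h).mono (by gcongr; linarith)
  -- For small `δ`, apply the forward estimate to `perturbed a F δ` and its inverse shift; both have
  -- derivative bounds independent of `δ`.
  by_cases hδM : |δ| * M ≤ 1 / 2
  · obtain ⟨s, hs, hsF⟩ := exists_inverse_shift hF.smooth hFL hδM
    have := formLE_perturbed (hpert δ hδ) hS0 (hS δ hδ hδM s hs hsF) hδ h
    rw [perturbed_perturbed hsF] at this
    exact this.mono (by gcongr; linarith)
  -- Otherwise `2(M + 1)|δ| ≥ 1`, so the crude gap `cvConst d * (B + B')` between the two norm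
  -- bounds is itself at most `C3 * |δ|`.
  · have hE := h.neg_le ((hpert δ hδ).mono (by omega) le_rfl)
    refine (formLE_of_derivBound (hB.mono (by omega) le_rfl)).mono ?_
    have h4 : 1 ≤ 2 * (M + 1) * |δ| := by nlinarith [abs_nonneg δ]
    have h5 : cvConst d * (B + B') * 1 ≤ cvConst d * (B + B') * (2 * (M + 1) * |δ|) := by gcongr
    have h6 : C3 * |δ| ≤ (C1 + C2 + C3) * |δ| := by gcongr; linarith
    simp only [C3] at h6
    linarith

/-- At `δ = 0` the perturbation is the constant shift `F 0`, which need not vanish but leaves form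
bounds unchanged. -/
lemma formLE_perturbed_zero_iff {a : Eucl d × Eucl d → ℝ} {F : Eucl d → Eucl d} {E : ℝ} :
    FormLE (perturbed a F 0) E ↔ FormLE a E := by
  have e : perturbed a F 0 = fun p => a (p.1 + F 0, p.2) := by
    ext p; simp [perturbed]
  rw [e]
  refine ⟨fun h => ?_, fun h => h.translate _⟩
  simpa using h.translate (-F 0)

lemma IsWeylQuantization.upperEdge_le_iff {b : Eucl d × Eucl d → ℝ} {A : L2 d →L[ℂ] L2 d}
    (h : IsWeylQuantization b A) (hA : IsSelfAdjoint A) (E : ℝ) :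
    upperEdge A ≤ E ↔ FormLE b E := by
  rw [WeylEdges.upperEdge_le_iff hA]
  refine forall_congr' fun φ => ?_
  rw [← h φ φ]
  rfl

lemma IsWeylQuantization.neg {b : Eucl d × Eucl d → ℝ} {A : L2 d →L[ℂ] L2 d}
    (h : IsWeylQuantization b A) : IsWeylQuantization (fun p => -b p) (-A) := fun ψ φ => by
  rw [weylForm_neg, ← h ψ φ, neg_apply, inner_neg_right]

/-- Each edge is itself an admissible form bound; transferring it to the other symbol gives one of
the two inequalities. -/
lemma abs_upperEdge_sub_le {a : Eucl d × Eucl d → ℝ} {F : Eucl d → Eucl d} {C δ : ℝ}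
    (hC : ∀ E, (FormLE a E → FormLE (perturbed a F δ) (E + C * |δ|)) ∧
      (FormLE (perturbed a F δ) E → FormLE a (E + C * |δ|)))
    {A A₀ : L2 d →L[ℂ] L2 d} (hA : IsWeylQuantization (perturbed a F δ) A)
    (hA₀ : IsWeylQuantization (perturbed a F 0) A₀) (hsA : IsSelfAdjoint A)
    (hsA₀ : IsSelfAdjoint A₀) : |upperEdge A - upperEdge A₀| ≤ C * |δ| := by
  have h := (hA.upperEdge_le_iff hsA _).1 le_rfl
  have h₀ := formLE_perturbed_zero_iff.1 ((hA₀.upperEdge_le_iff hsA₀ _).1 le_rfl)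
  have h1 := (hA.upperEdge_le_iff hsA _).2 ((hC _).1 h₀)
  have h2 := (hA₀.upperEdge_le_iff hsA₀ _).2 (formLE_perturbed_zero_iff.2 ((hC _).2 h))
  rw [abs_le]
  constructor <;> linarith

lemma IsSymbol.neg {a : Eucl d × Eucl d → ℝ} (ha : IsSymbol a) : IsSymbol (fun p => -a p) :=
  ⟨ha.smooth.neg, fun n => (ha.bounded n).imp fun C hC p => by
    have : (fun p => -a p) = -a := rfl
    rw [this, iteratedFDeriv_neg_apply, norm_neg]
    exact hC p⟩

end

end WeylEdges

end

/-! ### Assembling the theorem. -/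

theorem theorem2 (d : ℕ)
    (a : WeylEdges.Eucl d × WeylEdges.Eucl d → ℝ) (ha : WeylEdges.IsSymbol a)
    (F : WeylEdges.Eucl d → WeylEdges.Eucl d) (hF : WeylEdges.IsShift F) :
    ∃ K : ℝ → (WeylEdges.L2 d →L[ℂ] WeylEdges.L2 d),
      (∀ δ : ℝ, IsSelfAdjoint (K δ) ∧
        ∀ A : WeylEdges.L2 d →L[ℂ] WeylEdges.L2 d,
          WeylEdges.IsWeylQuantization (WeylEdges.perturbed a F δ) A ↔ A = K δ) ∧
      ∃ C : ℝ, 0 < C ∧ ∀ δ : ℝ, |δ| ≤ 1 →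
        |WeylEdges.upperEdge (K δ) - WeylEdges.upperEdge (K 0)| ≤ C * |δ| ∧
        |WeylEdges.lowerEdge (K δ) - WeylEdges.lowerEdge (K 0)| ≤ C * |δ| := by
  obtain ⟨B, hB⟩ := ha.exists_derivBound (WeylEdges.cvOrder d)
  obtain ⟨M, hM0, hM⟩ := hF.exists_posDerivBound (WeylEdges.cvOrder d)
  have hb := fun δ => WeylEdges.derivBound_perturbed hB hM0 hM δ
  choose K hK _ using fun δ => WeylEdges.exists_isWeylQuantization (hb δ)
  have hsa : ∀ δ, IsSelfAdjoint (K δ) := fun δ =>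
    (hK δ).isSelfAdjoint (hb δ).smooth.continuous (fun p => (hb δ).norm_le p)
  refine ⟨K, fun δ => ⟨hsa δ, fun A => ⟨fun h => h.unique (hK δ), fun h => h ▸ hK δ⟩⟩, ?_⟩
  obtain ⟨C, hC0, hC⟩ := WeylEdges.exists_formLE_perturbed ha hF
  -- The constant for `-a` controls the lower edge, because perturbing commutes with negating the
  -- symbol. The `+ 1` below only secures strict positivity.
  obtain ⟨C', hC'0, hC'⟩ := WeylEdges.exists_formLE_perturbed ha.neg hF
  refine ⟨C + C' + 1, by positivity, fun δ hδ => ⟨?_, ?_⟩⟩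
  · refine (WeylEdges.abs_upperEdge_sub_le (hC δ hδ) (hK δ) (hK 0) (hsa δ) (hsa 0)).trans ?_
    gcongr
    linarith
  · have h := WeylEdges.abs_upperEdge_sub_le (hC' δ hδ) (hK δ).neg (hK 0).neg (hsa δ).neg (hsa 0).neg
    rw [WeylEdges.lowerEdge_eq, WeylEdges.lowerEdge_eq, neg_sub_neg, abs_sub_comm]
    refine h.trans ?_
    gcongr
    linarith
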